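/- Let $b>0$, $F(r)=1-r^{-3}-br^{-4}$, let $r_s$ be the largest positive root of $F$, let $P_x>0$ be arbitrary and $P_y=\frac{4\pi}{r_s^2F'(r_s)}$. Let $T^2=\mathbb R^2/(P_x\mathbb Z\times P_y\mathbb Z)$ with coordinates $(x,y)$, and let $M$ be the AdS-Melvin space, i.e. the solid torus covered, away from its core circle $\{r=r_s\}$, by coordinates $(r,x,y)\in(r_s,\infty)\times T^2$, with the metric $$\bar g=r^{-2}F(r)^{-1}\,dr^2+r^2\,dx^2+r^2F(r)\,dy^2 .$$ For a graph $\Sigma=\{r=s(x,y)\}$ with $s:T^2\to(r_s,\infty)$ smooth, let $\nu$ be the outward unit normal (the one with positive $\partial_r$-component), $H$ the mean curvature with respect to $\nu$ (the trace of $\bar g(\bar\nabla_\cdot\,\nu,\cdot)$), $dA$ the area form, $dV$ the volume form of $\bar g$, $\Omega=\{r<s(x,y)\}$ the region enclosed by $\Sigma$, and $$Q(\Sigma)=\int_\Sigma Hr\,dA-6\int_\Omega r\,dV .$$ Let $0<T_0\le\infty$ and let $\varphi:[0,T_0)\times T^2\to M$ be a smooth family of embeddings whose images $\Sigma_t=\varphi(t,T^2)$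 are graphs $\{r=s(t,x,y)\}$ with $s:[0,T_0)\times T^2\to(r_s,\infty)$ smooth, and which satisfies $$\frac{\partial\varphi}{\partial t}=r^{-1}\nu .$$ Then for every $t\in[0,T_0)$ the function $t\mapsto Q(\Sigma_t)$ is differentiable at $t$ (one-sidedly at $t=0$) and $$\frac{d}{dt}Q(\Sigma_t)\le 0 .$$ Moreover, for each $t$, equality holds if and only if $\Sigma_t$ is a coordinate torus $\{r\equiv\mathrm{const}\}$. -/

import Mathlib

open scoped ContDiff

noncomputable section

namespace AdSMelvin

/-! ### Coordinates

Points of the ambient space are written in coordinates `p = ![r, x, y]`, where `x` and `y` are the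
lifts to `ℝ` of the two angular coordinates, which have periods `Px` and `Py`.  Functions and maps
on the torus `T² = ℝ² / (Px ℤ × Py ℤ)` are written as functions on `ℝ²` with the corresponding
periodicity. -/

/-- The partial derivative `∂f/∂xⁱ` at `p`. -/
def pd {n : ℕ} (i : Fin n) (f : (Fin n → ℝ) → ℝ) (p : Fin n → ℝ) : ℝ :=
  fderiv ℝ f p (Pi.single i 1)

/-! ### Riemannian geometry of coordinate patches -/

/-- The Christoffel symbol `Γᶜ_{ab}` at `p` of the Levi-Civita connection of a metric `g`. -/
def christoffel {n : ℕ} (g : (Fin n → ℝ) → Matrix (Fin n) (Fin n) ℝ) (p : Fin n → ℝ)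
    (c a b : Fin n) : ℝ :=
  (1 / 2) * ∑ d, (g p)⁻¹ c d *
    (pd a (fun q => g q b d) p + pd b (fun q => g q a d) p - pd d (fun q => g q a b) p)

/-- The inner product of `v` and `w` with respect to a metric with matrix `G`. -/
def metricInner {n : ℕ} (G : Matrix (Fin n) (Fin n) ℝ) (v w : Fin n → ℝ) : ℝ :=
  ∑ a, ∑ b, G a b * v a * w b

/-- The tangent vector `∂X/∂uⁱ` of a parametrized surface `X`. -/
def tangentVec (X : (Fin 2 → ℝ) → (Fin 3 → ℝ)) (i : Fin 2) (u : Fin 2 → ℝ) : Fin 3 → ℝ :=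
  fun a => pd i (fun w => X w a) u

/-- The induced metric `g_{ij}` of a parametrized surface. -/
def firstForm (g : (Fin 3 → ℝ) → Matrix (Fin 3) (Fin 3) ℝ) (X : (Fin 2 → ℝ) → (Fin 3 → ℝ))
    (u : Fin 2 → ℝ) : Matrix (Fin 2) (Fin 2) ℝ :=
  Matrix.of fun i j => metricInner (g (X u)) (tangentVec X i u) (tangentVec X j u)

/-- The covariant derivative of `∂X/∂uʲ` in the direction `∂X/∂uⁱ`, for the Levi-Civita
connection of the ambient metric `g`. -/
def covTangent (g : (Fin 3 → ℝ) → Matrix (Fin 3) (Fin 3) ℝ) (X : (Fin 2 → ℝ) → (Fin 3 → ℝ))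
    (i j : Fin 2) (u : Fin 2 → ℝ) : Fin 3 → ℝ :=
  fun c => pd i (fun w => tangentVec X j w c) u +
    ∑ a, ∑ b, christoffel g (X u) c a b * tangentVec X i u a * tangentVec X j u b

/-- The second fundamental form `h_{ij} = - ⟨D_i ∂_j X, ν⟩` (equivalently `⟨D_i ν, ∂_j X⟩`) with
respect to a unit normal field `ν`; round spheres have positive mean curvature with respect to the
outward normal. -/
def secondForm (g : (Fin 3 → ℝ) → Matrix (Fin 3) (Fin 3) ℝ) (X : (Fin 2 → ℝ) → (Fin 3 → ℝ))
    (ν : (Fin 2 → ℝ) → (Fin 3 → ℝ)) (u : Fin 2 → ℝ) : Matrix (Fin 2) (Fin 2) ℝ :=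
  Matrix.of fun i j => - metricInner (g (X u)) (covTangent g X i j u) (ν u)

/-- The mean curvature `H = g^{ij} h_{ij}`. -/
def meanCurvature (g : (Fin 3 → ℝ) → Matrix (Fin 3) (Fin 3) ℝ) (X : (Fin 2 → ℝ) → (Fin 3 → ℝ))
    (ν : (Fin 2 → ℝ) → (Fin 3 → ℝ)) (u : Fin 2 → ℝ) : ℝ :=
  ∑ i, ∑ j, (firstForm g X u)⁻¹ i j * secondForm g X ν u i j

/-- The density of the area form `dA` with respect to `du¹ du²`. -/
def areaDensity (g : (Fin 3 → ℝ) → Matrix (Fin 3) (Fin 3) ℝ) (X : (Fin 2 → ℝ) → (Fin 3 → ℝ))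
    (u : Fin 2 → ℝ) : ℝ :=
  Real.sqrt (firstForm g X u).det

/-- The density of the volume form `dV` with respect to the coordinate measure. -/
def volumeDensity (g : (Fin 3 → ℝ) → Matrix (Fin 3) (Fin 3) ℝ) (p : Fin 3 → ℝ) : ℝ :=
  Real.sqrt (g p).det

/-! ### The AdS-Melvin space -/

/-- `F(r) = 1 - r⁻³ - b r⁻⁴`. -/
def warp (b r : ℝ) : ℝ := 1 - (r ^ 3)⁻¹ - b * (r ^ 4)⁻¹

/-- `rs` is the largest positive root of `F`. -/
def IsCoreRadius (b rs : ℝ) : Prop := IsGreatest {r : ℝ | 0 < r ∧ warp b r = 0} rs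

/-- The period `4π / (rs² F'(rs))` of the coordinate `y`. -/
def periodY (b rs : ℝ) : ℝ := 4 * Real.pi / (rs ^ 2 * deriv (warp b) rs)

/-- The AdS-Melvin metric `r⁻² F(r)⁻¹ dr² + r² dx² + r² F(r) dy²`. -/
def metric (b : ℝ) (p : Fin 3 → ℝ) : Matrix (Fin 3) (Fin 3) ℝ :=
  Matrix.diagonal
    ![((p 0) ^ 2)⁻¹ * (warp b (p 0))⁻¹, (p 0) ^ 2, (p 0) ^ 2 * warp b (p 0)]

/-! ### Graphs over the torus -/

/-- `s` is a smooth function on the torus with values in the range `(rs, ∞)` of the coordinate `r`,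
i.e. the height function of an embedded graph over the torus. -/
structure IsHeightFunction (rs Px Py : ℝ) (s : (Fin 2 → ℝ) → ℝ) : Prop where
  smooth : ContDiff ℝ ∞ s
  periodic_x : ∀ p, s (p + ![Px, 0]) = s p
  periodic_y : ∀ p, s (p + ![0, Py]) = s p
  gt_core : ∀ p, rs < s p

/-- The parametrization `(x, y) ↦ (s(x, y), x, y)` of the graph `{r = s(x, y)}`. -/
def graphMap (s : (Fin 2 → ℝ) → ℝ) (p : Fin 2 → ℝ) : Fin 3 → ℝ := ![s p, p 0, p 1]

/-- The graph `{r = s(x, y)}`, as a set of coordinate triples. -/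
def graphSet (s : (Fin 2 → ℝ) → ℝ) : Set (Fin 3 → ℝ) := Set.range (graphMap s)

/-- The differential `dr - s_x dx - s_y dy` of the defining function `r - s(x, y)`. -/
def conormal (s : (Fin 2 → ℝ) → ℝ) (p : Fin 2 → ℝ) : Fin 3 → ℝ :=
  ![1, - pd 0 s p, - pd 1 s p]

/-- The outward unit normal `ν` of the graph `{r = s(x, y)}` at the point over `(x, y)`: the
normalized gradient of `r - s(x, y)`. -/
def unitNormal (b : ℝ) (s : (Fin 2 → ℝ) → ℝ) (p : Fin 2 → ℝ) : Fin 3 → ℝ :=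
  (Real.sqrt (metricInner (metric b (graphMap s p))⁻¹ (conormal s p) (conormal s p)))⁻¹ •
    ((metric b (graphMap s p))⁻¹).mulVec (conormal s p)

/-- The mean curvature `H` of the graph with respect to the outward unit normal. -/
def graphMeanCurvature (b : ℝ) (s : (Fin 2 → ℝ) → ℝ) (p : Fin 2 → ℝ) : ℝ :=
  meanCurvature (metric b) (graphMap s) (unitNormal b s) p

/-- `∫_Σ H r dA` for the graph `Σ = {r = s(x, y)}`. -/
def weightedMeanCurvatureIntegral (b Px Py : ℝ) (s : (Fin 2 → ℝ) → ℝ) : ℝ :=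
  ∫ x in (0 : ℝ)..Px, ∫ y in (0 : ℝ)..Py,
    graphMeanCurvature b s ![x, y] * s ![x, y] * areaDensity (metric b) (graphMap s) ![x, y]

/-- `∫_Ω r dV` for the region `Ω = {rs < r < s(x, y)}` enclosed by the graph (the core circle
`{r = rs}` of the solid torus has measure zero). -/
def weightedVolume (b rs Px Py : ℝ) (s : (Fin 2 → ℝ) → ℝ) : ℝ :=
  ∫ x in (0 : ℝ)..Px, ∫ y in (0 : ℝ)..Py, ∫ r in rs..(s ![x, y]),
    r * volumeDensity (metric b) ![r, x, y]

/-- `Q(Σ) = ∫_Σ H r dA - 6 ∫_Ω r dV` for the graph `Σ = {r = s(x, y)}`. -/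
def Q (b rs Px Py : ℝ) (s : (Fin 2 → ℝ) → ℝ) : ℝ :=
  weightedMeanCurvatureIntegral b Px Py s - 6 * weightedVolume b rs Px Py s

/-- The graph of `s` is a coordinate torus `{r ≡ const}`. -/
def IsCoordinateTorus (s : (Fin 2 → ℝ) → ℝ) : Prop := ∃ c : ℝ, ∀ p, s p = c

/-! ### The normal flow -/

/-- The time interval `[0, T₀)`, where `T₀ = ∞` is allowed. -/
def timeInterval (T₀ : EReal) : Set ℝ := {t : ℝ | 0 ≤ t ∧ (t : EReal) < T₀}

/-- The parameters `u`, `v` represent the same point of the torus. -/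
def TorusEq (Px Py : ℝ) (u v : Fin 2 → ℝ) : Prop :=
  ∃ m n : ℤ, v = u + ![m * Px, n * Py]

/-- The coordinate triples `p`, `q` represent the same point of the ambient space. -/
def SpaceEq (Px Py : ℝ) (p q : Fin 3 → ℝ) : Prop :=
  ∃ m n : ℤ, q = p + ![0, m * Px, n * Py]

/-- `X` is (the lift of) a smooth embedding of the torus into the ambient space, with
image the graph `{r = s(x, y)}`.  Since the torus is compact, an embedding is the same as an
injective immersion. -/
structure IsEmbeddedGraph (Px Py : ℝ) (X : (Fin 2 → ℝ) → (Fin 3 → ℝ)) (s : (Fin 2 → ℝ) → ℝ) :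
    Prop where
  smooth : ContDiff ℝ ∞ X
  descends : ∀ u v, TorusEq Px Py u v → SpaceEq Px Py (X u) (X v)
  injective : ∀ u v, SpaceEq Px Py (X u) (X v) → TorusEq Px Py u v
  immersion : ∀ u, LinearIndependent ℝ ![tangentVec X 0 u, tangentVec X 1 u]
  image_eq : {p | ∃ u, SpaceEq Px Py (X u) p} = graphSet s

/-- `φ : [0, T₀) × T² → M` is a smooth family of embedded graphs over the torus, with images
`Σ_t = {r = s(t, x, y)}`, that solves `∂φ/∂t = r⁻¹ ν`, where `ν` is the outward unit normal of
`Σ_t`.  (At `t = 0` the time derivative is one-sided.) -/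
structure IsNormalFlow (b rs Px Py : ℝ) (T₀ : EReal) (φ : ℝ → (Fin 2 → ℝ) → (Fin 3 → ℝ))
    (s : ℝ → (Fin 2 → ℝ) → ℝ) : Prop where
  smooth : ContDiffOn ℝ ∞ (fun q : ℝ × (Fin 2 → ℝ) => φ q.1 q.2)
    (timeInterval T₀ ×ˢ Set.univ)
  smooth_height : ContDiffOn ℝ ∞ (fun q : ℝ × (Fin 2 → ℝ) => s q.1 q.2)
    (timeInterval T₀ ×ˢ Set.univ)
  height : ∀ t ∈ timeInterval T₀, IsHeightFunction rs Px Py (s t)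
  embedded : ∀ t ∈ timeInterval T₀, IsEmbeddedGraph Px Py (φ t) (s t)
  flow : ∀ t ∈ timeInterval T₀, ∀ u,
    HasDerivWithinAt (fun τ => φ τ u)
      ((φ t u 0)⁻¹ • unitNormal b (s t) ![φ t u 1, φ t u 2]) (timeInterval T₀) t

end AdSMelvin

end

open scoped ContDiff

noncomputable section

namespace AdSMelvin

/-! ### Jet polynomials of a graph

Throughout, `f = r² F(r)`, `f1 = f'`, `f2 = f''` are evaluated at `r = s`; `p, q` are the first
partial derivatives of `s`, and `a, b, c` the second ones.  Primes denote derivatives in some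
direction. -/

/-! Write the metric as dr²/f + r² dx² + f dy² with f = r² F(r). For a surface moving with normal
speed 1/r, the standard variation formulas give d/dt (H r dA) = [(H² − |h|²) − Ric(ν,ν) − r Δ(1/r) +
H ν(r)/r] dA. Since Δr = tr_Σ Hess r − H ν(r), the terms linear in H cancel and the only
second-order term left is H² − |h|² = 2 det h / det g. The weight r and the speed 1/r cancel, so
this term carries constant weight. The Gauss equation turns it into 2K plus an ambient curvature
term, and K integrates to zero over a torus. What remains depends on the first jet of the height
function only.

The proof carries this out in the graph gauge. There the height function satisfies s_t = |d(r −
s)|/s (`IsNormalFlow.height_speed`), and passing from normal to vertical motion adds the divergence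
of a transport term. Two pointwise algebraic identities hold the geometry: `firstVariation_identity`
is the variation formula and `gaussBonnet_identity` is the Gauss equation with K dA as an explicit
divergence. Both hold for arbitrary f. `hasDirDeriv_curvDensity_of_flow` combines them, and all
divergences integrate to zero by periodicity.

The particular F enters in `reaction_eq_sub_defect`: the reaction term is 6 s² s_t − `defect`. The
first summand is exactly the derivative of 6 ∫ r dV, because r dV = r² dr dx dy. Hence dQ/dt = −∫
`defect`. For b > 0 the defect is a positive weight times a positive definite quadratic form in ds,
which gives both the sign and the equality case. -/

/-- `D = s² f |d(r - s)|²`, where `|d(r - s)|² = f + p² / s² + q² / f`. -/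
def gradPoly (f s p q : ℝ) : ℝ := f * (s ^ 2 * f + p ^ 2) + s ^ 2 * q ^ 2

/-- The directional derivative of `gradPoly`. -/
def gradPolyD (f f1 s p q s' p' q' : ℝ) : ℝ :=
  2*f*f1*s'*s^2 + 2*f^2*s*s' + f1*s'*p^2 + 2*f*p*p' + 2*s*s'*q^2 + 2*s^2*q*q'

/-- The second directional derivative of `gradPoly`. -/
def gradPolyDD (f f1 f2 s p q s' p' q' s1 p1 q1 s1' p1' q1' : ℝ) : ℝ :=
  2*f1*s1*f1*s'*s^2 + 2*f*f2*s1*s'*s^2 + 2*f*f1*s1'*s^2 + 2*f*f1*s'*(2*s*s1)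
  + 4*f*f1*s1*s*s' + 2*f^2*s1*s' + 2*f^2*s*s1' + f2*s1*s'*p^2 + f1*s1'*p^2 + f1*s'*(2*p*p1)
  + 2*f1*s1*p*p' + 2*f*p1*p' + 2*f*p*p1' + 2*s1*s'*q^2 + 2*s*s1'*q^2 + 2*s*s'*(2*q*q1)
  + 4*s*s1*q*q' + 2*s^2*q1*q' + 2*s^2*q*q1'

/-- The numerator of `H r dA`. -/
def curvPoly (f f1 s p q a b c : ℝ) : ℝ :=
  (f^2+q^2)*(2*f*s*a - f1*p^2*s - 2*f^2*s^2 - 4*f*p^2) - 2*p*q*(2*f*s*b - 2*p*q*(f1*s + f))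
  + (s^2*f+p^2)*(2*f*s*c - 3*f1*q^2*s - f^2*f1*s)

/-- The directional derivative of `curvPoly`. -/
def curvPolyD (f f1 f2 s p q a b c s' p' q' a' b' c' : ℝ) : ℝ :=
  (2*f*f1*s'+2*q*q')*(2*f*s*a - f1*p^2*s - 2*f^2*s^2 - 4*f*p^2)
  + (f^2+q^2)*(2*f1*s'*s*a + 2*f*s'*a + 2*f*s*a' - f2*s'*p^2*s - 2*f1*p*p'*s - f1*p^2*s'
     - 4*f*f1*s'*s^2 - 4*f^2*s*s' - 4*f1*s'*p^2 - 8*f*p*p')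
  - 2*(p'*q+p*q')*(2*f*s*b - 2*p*q*(f1*s + f))
  - 2*p*q*(2*f1*s'*s*b + 2*f*s'*b + 2*f*s*b' - 2*(p'*q+p*q')*(f1*s + f)
    - 2*p*q*(f2*s'*s+2*f1*s'))
  + (2*s*s'*f+s^2*f1*s'+2*p*p')*(2*f*s*c - 3*f1*q^2*s - f^2*f1*s)
  + (s^2*f+p^2)*(2*f1*s'*s*c+2*f*s'*c+2*f*s*c' - 3*f2*s'*q^2*s - 6*f1*q*q'*s - 3*f1*q^2*s'
    - 2*f*f1*s'*f1*s - f^2*f2*s'*s - f^2*f1*s')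

/-- The density of `H r dA`. -/
def curvDensity (f f1 s p q a b c : ℝ) : ℝ :=
  -s * curvPoly f f1 s p q a b c / (2 * f * gradPoly f s p q)

/-- The directional derivative of `curvDensity`. -/
def curvDensityD (f f1 f2 s p q a b c s' p' q' a' b' c' : ℝ) : ℝ :=
  curvDensity f f1 s p q a b c *
      (s'/s - f1*s'/f - gradPolyD f f1 s p q s' p' q' / gradPoly f s p q)
    - s/(2*f*gradPoly f s p q)*curvPolyD f f1 f2 s p q a b c s' p' q' a' b' c'

/-- The normal speed `s_t = |d(r - s)| / s` of the height function. -/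
def speed (f s p q : ℝ) : ℝ := Real.sqrt (f + p ^ 2 / s ^ 2 + q ^ 2 / f) / s

/-- The logarithmic directional derivative of `speed`. -/
def logSpeedD (f f1 s p q s' p' q' : ℝ) : ℝ :=
  gradPolyD f f1 s p q s' p' q' / (2 * gradPoly f s p q) - 2*s'/s - f1*s'/(2*f)

/-- The directional derivative of `logSpeedD`. -/
def logSpeedDD (f f1 f2 s p q s' p' q' s1 p1 q1 s1' p1' q1' : ℝ) : ℝ :=
  gradPolyDD f f1 f2 s p q s' p' q' s1 p1 q1 s1' p1' q1' / (2 * gradPoly f s p q)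
    - gradPolyD f f1 s p q s' p' q' * gradPolyD f f1 s p q s1 p1 q1 / (2*(gradPoly f s p q)^2)
    - 2*s1'/s + 2*s'*s1/s^2 - (f2*s1*s' + f1*s1')/(2*f) + f1*s'*f1*s1/(2*f^2)

/-- The `y`-component of the Gauss–Bonnet potential of a graph, times `speed`. -/
def gaussFluxY (f f1 s p q a : ℝ) : ℝ :=
  q * (a + (-f1*p^2/(2*f) - f*s - 2*p^2/s)) / (s^2*f+p^2)

/-- Minus the `x`-component of the Gauss–Bonnet potential of a graph, times `speed`. -/
def gaussFluxX (f f1 s p q b : ℝ) : ℝ :=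
  q * (b - p*q*(f1/(2*f)+1/s)) / (s^2*f+p^2) + p*f1/(2*s^2)

/-- The directional derivative of `gaussFluxY`. -/
def gaussFluxYD (f f1 f2 s p q a s' p' q' a' : ℝ) : ℝ :=
  (q'*(a+(-f1*p^2/(2*f) - f*s - 2*p^2/s)) + q*(a' - (f2*s'*p^2 + f1*2*p*p')/(2*f)
      + f1*p^2/(2*f^2)*f1*s' - f1*s'*s - f*s' - 4*p*p'/s + 2*p^2/s^2*s'))/(s^2*f+p^2)
    - q*(a+(-f1*p^2/(2*f) - f*s - 2*p^2/s))/(s^2*f+p^2)^2*(2*s*s'*f+s^2*f1*s'+2*p*p')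

/-- The directional derivative of `gaussFluxX`. -/
def gaussFluxXD (f f1 f2 s p q b s' p' q' b' : ℝ) : ℝ :=
  (q'*(b - p*q*(f1/(2*f)+1/s)) + q*(b' - (p'*q+p*q')*(f1/(2*f)+1/s)
      - p*q*(f2*s'/(2*f) - f1/(2*f^2)*f1*s' - s'/s^2)))/(s^2*f+p^2)
    - q*(b - p*q*(f1/(2*f)+1/s))/(s^2*f+p^2)^2*(2*s*s'*f+s^2*f1*s'+2*p*p')
    + (p'*f1+p*f2*s')/(2*s^2) - p*f1/s^3*s'

/-- The determinant of the second fundamental form, times `|d(r - s)|²`. -/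
def secondFormDet (f f1 s p q a b c : ℝ) : ℝ :=
  (a + (-f1*p^2/(2*f) - f*s - 2*p^2/s)) * (c + (-3*f1*q^2/(2*f) - f*f1/2))
    - (b + (-p*q*(f1/f+1/s)))^2

/-! ### The two pointwise algebraic identities -/

/-- The Gauss equation of a graph, with the Gauss curvature written as a divergence. -/
theorem gaussBonnet_identity {s p q a b c d2 f f1 f2 : ℝ} (hs : s ≠ 0) (hf : f ≠ 0)
    (hL : s^2*f+p^2 ≠ 0) (hD : gradPoly f s p q ≠ 0) :
    s^4*f/gradPoly f s p q * (gaussFluxYD f f1 f2 s p q a q b c d2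
        - gaussFluxXD f f1 f2 s p q b p a b d2
        - logSpeedD f f1 s p q q b c * gaussFluxY f f1 s p q a
        + logSpeedD f f1 s p q p a b * gaussFluxX f f1 s p q b)
      = secondFormDet f f1 s p q a b c * s^4*f^2/(gradPoly f s p q)^2 - s*f1/2
        + (f1/(2*s)-f2/2)*p^2*s^2*f/gradPoly f s p q := by
  -- The fluxes over `speed` are the terms of Liouville's formula K √g = ∂_y(√g Γ²₁₁/E) − ∂_x(√g
  -- Γ²₁₂/E), where E = (s²f + p²)/f is the squared length of the tangent vector over ∂_x. As s⁴f/D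
  -- = `speed`⁻², the left side is K √g / `speed`; the terms without the determinant are the ambient
  -- sectional curvature.
  unfold gaussFluxXD gaussFluxYD gaussFluxX gaussFluxY logSpeedD secondFormDet gradPolyD
  generalize hLq : s^2*f+p^2 = Lq at *
  generalize hDq : gradPoly f s p q = D at *
  field_simp
  unfold gradPoly at hDq
  subst hDq hLq
  ring

set_option maxHeartbeats 4000000 in
/-- The first variation of `H r dA` in the direction of the normal flow, divided by `speed`. -/
theorem firstVariation_identity {s p q a b c d1 d2 d3 d4 f f1 f2 l1 l2 : ℝ} (hs : s ≠ 0)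
    (hf : f ≠ 0) (hD : gradPoly f s p q ≠ 0)
    (h1 : l1 = logSpeedD f f1 s p q p a b) (h2 : l2 = logSpeedD f f1 s p q q b c) :
    curvDensityD f f1 f2 s p q a b c 1 l1 l2
        (logSpeedDD f f1 f2 s p q p a b p a b a d1 d2 + l1^2)
        (logSpeedDD f f1 f2 s p q p a b q b c b d2 d3 + l1*l2)
        (logSpeedDD f f1 f2 s p q q b c q b c c d3 d4 + l2^2)
      - (curvDensityD f f1 f2 s p q a b c p a b d1 d2 d3 * (p*f/gradPoly f s p q)
        + curvDensityD f f1 f2 s p q a b c q b c d2 d3 d4 * (q*s^2/gradPoly f s p q)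
        + curvDensity f f1 s p q a b c * (l1*(p*f/gradPoly f s p q)
          + l2*(q*s^2/gradPoly f s p q) + (a*f+p*f1*p)/gradPoly f s p q
          - p*f*gradPolyD f f1 s p q p a b/(gradPoly f s p q)^2
          + (c*s^2+2*q*s*q)/gradPoly f s p q
          - q*s^2*gradPolyD f f1 s p q q b c/(gradPoly f s p q)^2))
      = 2*secondFormDet f f1 s p q a b c*s^4*f^2/(gradPoly f s p q)^2 + s*f1 + s^2*f2/2 + f
        + ((f1/s-f2/2-3*f/s^2)*p^2*s^2*f - 2*f*s^2*q^2)/gradPoly f s p q := by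
  -- The direction (1, l1, l2, …) is the 2-jet of u = `speed` divided by u, since u_x = u l1 and
  -- u_xx = u (∂_x l1 + l1²). The subtracted bracket is div(J u V)/u with V = (p f, q s²)/D; here −u
  -- V is the horizontal velocity of the normal flow. The determinant term is (H² − |h|²) √g / u.
  subst h1 h2
  unfold curvDensityD curvDensity logSpeedDD logSpeedD secondFormDet gradPolyDD gradPolyD curvPolyD
    curvPoly
  generalize hDq : gradPoly f s p q = D at *
  field_simp
  unfold gradPoly at hDq
  subst hDq
  ring

/-! ### Directional derivatives within a set -/

variable {E : Type*} [NormedAddCommGroup E] [NormedSpace ℝ E]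

/-- `g` is differentiable within `S` at `x`, with derivative `g'` in the direction `v`. -/
def HasDirDeriv (S : Set E) (x v : E) (g : E → ℝ) (g' : ℝ) : Prop :=
  ∃ L : E →L[ℝ] ℝ, HasFDerivWithinAt g L S x ∧ L v = g'

namespace HasDirDeriv

variable {S : Set E} {x v : E} {g h : E → ℝ} {g' h' : ℝ}

theorem congr_deriv {g'' : ℝ} (hg : HasDirDeriv S x v g g') (e : g' = g'') :
    HasDirDeriv S x v g g'' := e ▸ hg

theorem const (c : ℝ) : HasDirDeriv S x v (fun _ => c) 0 :=
  ⟨0, hasFDerivWithinAt_const c x S, rfl⟩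

theorem add (hg : HasDirDeriv S x v g g') (hh : HasDirDeriv S x v h h') :
    HasDirDeriv S x v (fun y => g y + h y) (g' + h') := by
  obtain ⟨L, hL, rfl⟩ := hg
  obtain ⟨M, hM, rfl⟩ := hh
  exact ⟨L + M, hL.fun_add hM, rfl⟩

theorem sub (hg : HasDirDeriv S x v g g') (hh : HasDirDeriv S x v h h') :
    HasDirDeriv S x v (fun y => g y - h y) (g' - h') := by
  obtain ⟨L, hL, rfl⟩ := hg
  obtain ⟨M, hM, rfl⟩ := hh
  exact ⟨L - M, hL.fun_sub hM, rfl⟩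

theorem neg (hg : HasDirDeriv S x v g g') : HasDirDeriv S x v (fun y => -g y) (-g') := by
  obtain ⟨L, hL, rfl⟩ := hg
  exact ⟨-L, hL.fun_neg, rfl⟩

theorem mul (hg : HasDirDeriv S x v g g') (hh : HasDirDeriv S x v h h') :
    HasDirDeriv S x v (fun y => g y * h y) (g' * h x + g x * h') := by
  obtain ⟨L, hL, rfl⟩ := hg
  obtain ⟨M, hM, rfl⟩ := hh
  refine ⟨_, hL.fun_mul hM, ?_⟩
  simp
  ring

theorem comp {φ : ℝ → ℝ} {φ' : ℝ} (hφ : HasDerivAt φ φ' (g x)) (hg : HasDirDeriv S x v g g') :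
    HasDirDeriv S x v (fun y => φ (g y)) (φ' * g') := by
  obtain ⟨L, hL, rfl⟩ := hg
  exact ⟨φ' • L, hφ.comp_hasFDerivWithinAt x hL, rfl⟩

theorem pow (hg : HasDirDeriv S x v g g') (n : ℕ) :
    HasDirDeriv S x v (fun y => g y ^ n) (n * g x ^ (n - 1) * g') :=
  comp (hasDerivAt_pow n (g x)) hg

theorem inv (hg : HasDirDeriv S x v g g') (h0 : g x ≠ 0) :
    HasDirDeriv S x v (fun y => (g y)⁻¹) (-g' / g x ^ 2) :=
  (comp (hasDerivAt_inv h0) hg).congr_deriv (by ring)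

theorem div (hg : HasDirDeriv S x v g g') (hh : HasDirDeriv S x v h h') (h0 : h x ≠ 0) :
    HasDirDeriv S x v (fun y => g y / h y) (g' / h x - g x * h' / h x ^ 2) := by
  simp only [div_eq_mul_inv (g _)]
  exact (hg.mul (hh.inv h0)).congr_deriv (by ring)

theorem sqrt (hg : HasDirDeriv S x v g g') (h0 : g x ≠ 0) :
    HasDirDeriv S x v (fun y => Real.sqrt (g y)) (g' / (2 * Real.sqrt (g x))) :=
  (comp (Real.hasDerivAt_sqrt h0) hg).congr_deriv (by ring)

theorem congr (hg : HasDirDeriv S x v g g') (hx : x ∈ S) (e : ∀ y ∈ S, h y = g y) :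
    HasDirDeriv S x v h g' := by
  obtain ⟨L, hL, rfl⟩ := hg
  exact ⟨L, hL.congr e (e x hx), rfl⟩

theorem fderivWithin_eq (hg : HasDirDeriv S x v g g') (hS : UniqueDiffWithinAt ℝ S x) :
    fderivWithin ℝ g S x v = g' := by
  obtain ⟨L, hL, rfl⟩ := hg
  rw [hL.fderivWithin hS]

end HasDirDeriv

theorem _root_.DifferentiableWithinAt.hasDirDeriv {S : Set E} {x : E} {g : E → ℝ}
    (hg : DifferentiableWithinAt ℝ g S x) (v : E) :
    HasDirDeriv S x v g (fderivWithin ℝ g S x v) :=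
  ⟨_, hg.hasFDerivWithinAt, rfl⟩

/-! ### Directional derivatives of the jet functions -/

section Jets

variable {S : Set E} {x v : E} {f f1 f2 : ℝ → ℝ} {s p q a b c : E → ℝ}
  {s' p' q' a' b' c' : ℝ}

theorem hasDirDeriv_gradPoly (hf : HasDerivAt f (f1 (s x)) (s x)) (hs : HasDirDeriv S x v s s')
    (hp : HasDirDeriv S x v p p') (hq : HasDirDeriv S x v q q') :
    HasDirDeriv S x v (fun y => gradPoly (f (s y)) (s y) (p y) (q y))
      (gradPolyD (f (s x)) (f1 (s x)) (s x) (p x) (q x) s' p' q') := by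
  have hf' := HasDirDeriv.comp hf hs
  unfold gradPoly gradPolyD
  refine HasDirDeriv.congr_deriv
    ((hf'.mul (((hs.pow 2).mul hf').add (hp.pow 2))).add ((hs.pow 2).mul (hq.pow 2))) ?_
  norm_num
  ring

theorem hasDirDeriv_gradPolyD {s1 p1 q1 : E → ℝ} {s1' p1' q1' : ℝ}
    (hf : HasDerivAt f (f1 (s x)) (s x))
    (hf1 : HasDerivAt f1 (f2 (s x)) (s x)) (hs : HasDirDeriv S x v s s')
    (hp : HasDirDeriv S x v p p') (hq : HasDirDeriv S x v q q')
    (hs1 : HasDirDeriv S x v s1 s1') (hp1 : HasDirDeriv S x v p1 p1')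
    (hq1 : HasDirDeriv S x v q1 q1') :
    HasDirDeriv S x v
      (fun y => gradPolyD (f (s y)) (f1 (s y)) (s y) (p y) (q y) (s1 y) (p1 y) (q1 y))
      (gradPolyDD (f (s x)) (f1 (s x)) (f2 (s x)) (s x) (p x) (q x) (s1 x) (p1 x) (q1 x)
        s' p' q' s1' p1' q1') := by
  have hf' := HasDirDeriv.comp hf hs
  have hf1' := HasDirDeriv.comp hf1 hs
  unfold gradPolyD gradPolyDD
  apply HasDirDeriv.congr_deriv
  · with_reducible repeat' first
      | exact hs | exact hp | exact hq | exact hs1 | exact hp1 | exact hq1 | exact hf' | exact hf1'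
      | exact HasDirDeriv.const _ | apply HasDirDeriv.add | apply HasDirDeriv.pow
      | apply HasDirDeriv.mul
  · norm_num
    ring

theorem hasDirDeriv_curvPoly (hf : HasDerivAt f (f1 (s x)) (s x))
    (hf1 : HasDerivAt f1 (f2 (s x)) (s x)) (hs : HasDirDeriv S x v s s')
    (hp : HasDirDeriv S x v p p') (hq : HasDirDeriv S x v q q') (ha : HasDirDeriv S x v a a')
    (hb : HasDirDeriv S x v b b') (hc : HasDirDeriv S x v c c') :
    HasDirDeriv S x v
      (fun y => curvPoly (f (s y)) (f1 (s y)) (s y) (p y) (q y) (a y) (b y) (c y))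
      (curvPolyD (f (s x)) (f1 (s x)) (f2 (s x)) (s x) (p x) (q x) (a x) (b x) (c x)
        s' p' q' a' b' c') := by
  have hf' := HasDirDeriv.comp hf hs
  have hf1' := HasDirDeriv.comp hf1 hs
  unfold curvPoly curvPolyD
  apply HasDirDeriv.congr_deriv
  · with_reducible repeat' first
      | exact hs | exact hp | exact hq | exact ha | exact hb | exact hc | exact hf' | exact hf1'
      | exact HasDirDeriv.const _ | apply HasDirDeriv.add | apply HasDirDeriv.sub
      | apply HasDirDeriv.pow | apply HasDirDeriv.mul
  · norm_num
    ring

theorem hasDirDeriv_curvDensity (hf : HasDerivAt f (f1 (s x)) (s x))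
    (hf1 : HasDerivAt f1 (f2 (s x)) (s x)) (hs : HasDirDeriv S x v s s')
    (hp : HasDirDeriv S x v p p') (hq : HasDirDeriv S x v q q') (ha : HasDirDeriv S x v a a')
    (hb : HasDirDeriv S x v b b') (hc : HasDirDeriv S x v c c') (h0 : s x ≠ 0)
    (hf0 : f (s x) ≠ 0) (hD0 : gradPoly (f (s x)) (s x) (p x) (q x) ≠ 0) :
    HasDirDeriv S x v
      (fun y => curvDensity (f (s y)) (f1 (s y)) (s y) (p y) (q y) (a y) (b y) (c y))
      (curvDensityD (f (s x)) (f1 (s x)) (f2 (s x)) (s x) (p x) (q x) (a x) (b x) (c x)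
        s' p' q' a' b' c') := by
  have hf' := HasDirDeriv.comp hf hs
  have hD := hasDirDeriv_gradPoly hf hs hp hq
  have hM := hasDirDeriv_curvPoly hf hf1 hs hp hq ha hb hc
  unfold curvDensity curvDensityD
  refine HasDirDeriv.congr_deriv
    ((hs.neg.mul hM).div (((HasDirDeriv.const 2).mul hf').mul hD) (by positivity)) ?_
  unfold curvDensity
  field_simp
  ring

theorem hasDirDeriv_speed (hf : HasDerivAt f (f1 (s x)) (s x)) (hs : HasDirDeriv S x v s s')
    (hp : HasDirDeriv S x v p p') (hq : HasDirDeriv S x v q q') (h0 : 0 < s x)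
    (hf0 : 0 < f (s x)) :
    HasDirDeriv S x v (fun y => speed (f (s y)) (s y) (p y) (q y))
      (speed (f (s x)) (s x) (p x) (q x) *
        logSpeedD (f (s x)) (f1 (s x)) (s x) (p x) (q x) s' p' q') := by
  have hf' := HasDirDeriv.comp hf hs
  have hω : 0 < f (s x) + p x ^ 2 / s x ^ 2 + q x ^ 2 / f (s x) := by positivity
  have hD : 0 < gradPoly (f (s x)) (s x) (p x) (q x) := by unfold gradPoly; positivity
  unfold speed
  refine HasDirDeriv.congr_deriv (((((hf'.add ((hp.pow 2).div (hs.pow 2) (by positivity))).add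
    ((hq.pow 2).div hf' hf0.ne')).sqrt hω.ne').div hs h0.ne')) ?_
  set w := Real.sqrt (f (s x) + p x ^ 2 / s x ^ 2 + q x ^ 2 / f (s x)) with hw
  have hw0 : 0 < w := Real.sqrt_pos.2 hω
  -- This removes the root: after the substitution only w² occurs and the claim is rational.
  have hw2 : gradPoly (f (s x)) (s x) (p x) (q x) = s x ^ 2 * f (s x) * w ^ 2 := by
    rw [hw, Real.sq_sqrt hω.le, gradPoly]
    field_simp
  unfold logSpeedD
  rw [hw2]
  have hw2' := hw2
  unfold gradPoly at hw2'
  unfold gradPolyD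
  norm_num
  field_simp
  linear_combination (-1) * (f1 (s x) * s x * s' + 2 * s' * f (s x)) * hw2'

theorem hasDirDeriv_logSpeedD {s1 p1 q1 : E → ℝ} {s1' p1' q1' : ℝ}
    (hf : HasDerivAt f (f1 (s x)) (s x))
    (hf1 : HasDerivAt f1 (f2 (s x)) (s x)) (hs : HasDirDeriv S x v s s')
    (hp : HasDirDeriv S x v p p') (hq : HasDirDeriv S x v q q')
    (hs1 : HasDirDeriv S x v s1 s1') (hp1 : HasDirDeriv S x v p1 p1')
    (hq1 : HasDirDeriv S x v q1 q1') (h0 : s x ≠ 0)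
    (hf0 : f (s x) ≠ 0) (hD0 : gradPoly (f (s x)) (s x) (p x) (q x) ≠ 0) :
    HasDirDeriv S x v
      (fun y => logSpeedD (f (s y)) (f1 (s y)) (s y) (p y) (q y) (s1 y) (p1 y) (q1 y))
      (logSpeedDD (f (s x)) (f1 (s x)) (f2 (s x)) (s x) (p x) (q x) (s1 x) (p1 x) (q1 x)
        s' p' q' s1' p1' q1') := by
  have hf' := HasDirDeriv.comp hf hs
  have hf1' := HasDirDeriv.comp hf1 hs
  have hD := hasDirDeriv_gradPoly hf hs hp hq
  have hD' := hasDirDeriv_gradPolyD hf hf1 hs hp hq hs1 hp1 hq1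
  unfold logSpeedD logSpeedDD
  refine HasDirDeriv.congr_deriv
    (((hD'.div ((HasDirDeriv.const 2).mul hD) (by positivity)).sub
      (((HasDirDeriv.const 2).mul hs1).div hs h0)).sub
      ((hf1'.mul hs1).div ((HasDirDeriv.const 2).mul hf') (by positivity))) ?_
  field_simp
  ring

theorem hasDirDeriv_gaussFluxY (hf : HasDerivAt f (f1 (s x)) (s x))
    (hf1 : HasDerivAt f1 (f2 (s x)) (s x)) (hs : HasDirDeriv S x v s s')
    (hp : HasDirDeriv S x v p p') (hq : HasDirDeriv S x v q q') (ha : HasDirDeriv S x v a a')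
    (h0 : s x ≠ 0) (hf0 : f (s x) ≠ 0) (hL0 : s x ^ 2 * f (s x) + p x ^ 2 ≠ 0) :
    HasDirDeriv S x v (fun y => gaussFluxY (f (s y)) (f1 (s y)) (s y) (p y) (q y) (a y))
      (gaussFluxYD (f (s x)) (f1 (s x)) (f2 (s x)) (s x) (p x) (q x) (a x) s' p' q' a') := by
  have hf' := HasDirDeriv.comp hf hs
  have hf1' := HasDirDeriv.comp hf1 hs
  unfold gaussFluxY gaussFluxYD
  refine HasDirDeriv.congr_deriv
    ((hq.mul (ha.add ((((hf1'.neg.mul (hp.pow 2)).div ((HasDirDeriv.const 2).mul hf')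
      (by positivity)).sub (hf'.mul hs)).sub
      (((HasDirDeriv.const 2).mul (hp.pow 2)).div hs h0)))).div
      (((hs.pow 2).mul hf').add (hp.pow 2)) hL0) ?_
  norm_num
  field_simp
  ring

theorem hasDirDeriv_gaussFluxX (hf : HasDerivAt f (f1 (s x)) (s x))
    (hf1 : HasDerivAt f1 (f2 (s x)) (s x)) (hs : HasDirDeriv S x v s s')
    (hp : HasDirDeriv S x v p p') (hq : HasDirDeriv S x v q q') (hb : HasDirDeriv S x v b b')
    (h0 : s x ≠ 0) (hf0 : f (s x) ≠ 0) (hL0 : s x ^ 2 * f (s x) + p x ^ 2 ≠ 0) :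
    HasDirDeriv S x v (fun y => gaussFluxX (f (s y)) (f1 (s y)) (s y) (p y) (q y) (b y))
      (gaussFluxXD (f (s x)) (f1 (s x)) (f2 (s x)) (s x) (p x) (q x) (b x) s' p' q' b') := by
  have hf' := HasDirDeriv.comp hf hs
  have hf1' := HasDirDeriv.comp hf1 hs
  unfold gaussFluxX gaussFluxXD
  refine HasDirDeriv.congr_deriv
    (((hq.mul (hb.sub ((hp.mul hq).mul ((hf1'.div ((HasDirDeriv.const 2).mul hf')
      (by positivity)).add ((HasDirDeriv.const 1).div hs h0))))).div
      (((hs.pow 2).mul hf').add (hp.pow 2)) hL0).add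
      ((hp.mul hf1').div ((HasDirDeriv.const 2).mul (hs.pow 2)) (by positivity))) ?_
  norm_num
  field_simp
  ring

end Jets

/-! ### Jets of the height function along the flow, and evolution of H r dA -/

section Fields

variable {E : Type*} [NormedAddCommGroup E] [NormedSpace ℝ E]

/-- The derivative of `g` within `S` in the direction `v`. -/
def dirD (S : Set E) (v : E) (g : E → ℝ) (x : E) : ℝ := fderivWithin ℝ g S x v

variable {S : Set E} {x v w : E} {g h : E → ℝ}

theorem contDiffOn_dirD (hS : UniqueDiffOn ℝ S) (hg : ContDiffOn ℝ ∞ g S) (v : E) :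
    ContDiffOn ℝ ∞ (dirD S v g) S :=
  (hg.fderivWithin hS (by simp)).clm_apply contDiffOn_const

theorem hasDirDeriv_dirD (hg : ContDiffOn ℝ ∞ g S) (hx : x ∈ S) (v : E) :
    HasDirDeriv S x v g (dirD S v g x) :=
  ((hg x hx).differentiableWithinAt (by simp)).hasDirDeriv v

theorem HasDirDeriv.dirD_eq {g' : ℝ} (hg : HasDirDeriv S x v g g') (hS : UniqueDiffOn ℝ S)
    (hx : x ∈ S) : dirD S v g x = g' :=
  hg.fderivWithin_eq (hS x hx)

/-- Every point of S is a limit of interior points, so the symmetry of second derivatives extends to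
the boundary; this covers the initial time. -/
theorem dirD_comm (hS : UniqueDiffOn ℝ S) (hcl : S ⊆ closure (interior S))
    (hg : ContDiffOn ℝ ∞ g S) (hx : x ∈ S) :
    dirD S v (dirD S w g) x = dirD S w (dirD S v g) x := by
  have hd : DifferentiableWithinAt ℝ (fderivWithin ℝ g S) S x :=
    (hg.fderivWithin hS (m := ∞) (by simp) x hx).differentiableWithinAt (by simp)
  have key : ∀ v w : E, dirD S v (dirD S w g) x
      = fderivWithin ℝ (fderivWithin ℝ g S) S x v w := by
    intro v w
    have h1 := (hd.hasFDerivWithinAt.clm_apply (hasFDerivWithinAt_const w x S)).fderivWithin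
      (hS x hx)
    change fderivWithin ℝ (fun y => fderivWithin ℝ g S y w) S x v = _
    rw [h1]
    simp
  rw [key, key]
  exact (ContDiffWithinAt.isSymmSndFDerivWithinAt (n := ∞) (hg x hx)
    (by simp; exact WithTop.coe_le_coe.2 le_top) hS (hcl hx) hx).eq v w

/-- Linearity in the direction: it extracts the factor `speed` from the time derivative, leaving the
form used in `firstVariation_identity`. -/
theorem curvDensityD_smul (f f1 f2 s p q a b c u s' p' q' a' b' c' : ℝ) :
    curvDensityD f f1 f2 s p q a b c (u * s') (u * p') (u * q') (u * a') (u * b') (u * c')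
      = u * curvDensityD f f1 f2 s p q a b c s' p' q' a' b' c' := by
  unfold curvDensityD gradPolyD curvPolyD
  ring

theorem speed_pos {f s p q : ℝ} (hs : 0 < s) (hf : 0 < f) : 0 < speed f s p q := by
  unfold speed
  positivity

theorem gradPoly_pos {f s p q : ℝ} (hs : 0 < s) (hf : 0 < f) : 0 < gradPoly f s p q := by
  unfold gradPoly
  positivity

theorem gradPoly_eq_speed {f s p q : ℝ} (hs : 0 < s) (hf : 0 < f) :
    gradPoly f s p q = s ^ 4 * f * speed f s p q ^ 2 := by
  unfold speed gradPoly
  rw [div_pow, Real.sq_sqrt (by positivity)]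
  field_simp

/-- The first component of the flux in the evolution of `H r dA` along the normal flow. -/
def fluxX (f f1 : ℝ → ℝ) (s p q a b c : E → ℝ) (y : E) : ℝ :=
  curvDensity (f (s y)) (f1 (s y)) (s y) (p y) (q y) (a y) (b y) (c y)
      * (speed (f (s y)) (s y) (p y) (q y)
        * (p y * f (s y) / gradPoly (f (s y)) (s y) (p y) (q y)))
    - 2 * (gaussFluxX (f (s y)) (f1 (s y)) (s y) (p y) (q y) (b y)
        / speed (f (s y)) (s y) (p y) (q y))

/-- The second component of the flux in the evolution of `H r dA` along the normal flow. -/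
def fluxY (f f1 : ℝ → ℝ) (s p q a b c : E → ℝ) (y : E) : ℝ :=
  curvDensity (f (s y)) (f1 (s y)) (s y) (p y) (q y) (a y) (b y) (c y)
      * (speed (f (s y)) (s y) (p y) (q y)
        * (q y * s y ^ 2 / gradPoly (f (s y)) (s y) (p y) (q y)))
    + 2 * (gaussFluxY (f (s y)) (f1 (s y)) (s y) (p y) (q y) (a y)
        / speed (f (s y)) (s y) (p y) (q y))

/-- Along the normal flow, the density of `H r dA` evolves by a divergence plus a reaction term that
depends on the first jet of the height function only. -/
theorem hasDirDeriv_curvDensity_of_flow {e0 e1 eT : E} {f f1 f2 : ℝ → ℝ}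
    {s p q a b c : E → ℝ} (hS : UniqueDiffOn ℝ S) (hcl : S ⊆ closure (interior S))
    (hs : ContDiffOn ℝ ∞ s S) (hpos : ∀ y ∈ S, 0 < s y) (hfpos : ∀ y ∈ S, 0 < f (s y))
    (hf : ∀ r, 0 < r → HasDerivAt f (f1 r) r) (hf1 : ∀ r, 0 < r → HasDerivAt f1 (f2 r) r)
    (hp : p = dirD S e0 s) (hq : q = dirD S e1 s) (ha : a = dirD S e0 p) (hb : b = dirD S e1 p)
    (hc : c = dirD S e1 q)
    (hT : ∀ y ∈ S, dirD S eT s y = speed (f (s y)) (s y) (p y) (q y)) (hx : x ∈ S) :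
    ∃ X' Y' : ℝ, HasDirDeriv S x e0 (fluxX f f1 s p q a b c) X' ∧
      HasDirDeriv S x e1 (fluxY f f1 s p q a b c) Y' ∧
      HasDirDeriv S x eT
        (fun y => curvDensity (f (s y)) (f1 (s y)) (s y) (p y) (q y) (a y) (b y) (c y))
        (X' + Y' + speed (f (s x)) (s x) (p x) (q x) * (2 * s x * f1 (s x)
          + s x ^ 2 * f2 (s x) / 2 + f (s x)
          + ((f2 (s x) / 2 - 3 * f (s x) / s x ^ 2) * p x ^ 2 * s x ^ 2 * f (s x)
            - 2 * f (s x) * s x ^ 2 * q x ^ 2) / gradPoly (f (s x)) (s x) (p x) (q x))) := by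
  have hpC : ContDiffOn ℝ ∞ p S := hp ▸ contDiffOn_dirD hS hs e0
  have hqC : ContDiffOn ℝ ∞ q S := hq ▸ contDiffOn_dirD hS hs e1
  have haC : ContDiffOn ℝ ∞ a S := ha ▸ contDiffOn_dirD hS hpC e0
  have hbC : ContDiffOn ℝ ∞ b S := hb ▸ contDiffOn_dirD hS hpC e1
  have hcC : ContDiffOn ℝ ∞ c S := hc ▸ contDiffOn_dirD hS hqC e1
  have hb' : ∀ y ∈ S, dirD S e0 q y = b y := fun y hy => by
    rw [hb, hp, hq]
    exact dirD_comm hS hcl hs hy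
  -- spatial derivatives of the jets
  have s0 : ∀ y ∈ S, HasDirDeriv S y e0 s (p y) := fun y hy =>
    hp ▸ hasDirDeriv_dirD hs hy e0
  have s1 : ∀ y ∈ S, HasDirDeriv S y e1 s (q y) := fun y hy =>
    hq ▸ hasDirDeriv_dirD hs hy e1
  have p0 : ∀ y ∈ S, HasDirDeriv S y e0 p (a y) := fun y hy =>
    ha ▸ hasDirDeriv_dirD hpC hy e0
  have p1 : ∀ y ∈ S, HasDirDeriv S y e1 p (b y) := fun y hy =>
    hb ▸ hasDirDeriv_dirD hpC hy e1
  have q0 : ∀ y ∈ S, HasDirDeriv S y e0 q (b y) := fun y hy =>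
    hb' y hy ▸ hasDirDeriv_dirD hqC hy e0
  have q1 : ∀ y ∈ S, HasDirDeriv S y e1 q (c y) := fun y hy =>
    hc ▸ hasDirDeriv_dirD hqC hy e1
  -- Four third derivatives suffice: xxx, xxy, xyy, yyy. The other orders of differentiation reduce
  -- to these by commutation.
  obtain ⟨d1, hd1⟩ : ∃ d, d = dirD S e0 a x := ⟨_, rfl⟩
  obtain ⟨d2, hd2⟩ : ∃ d, d = dirD S e1 a x := ⟨_, rfl⟩
  obtain ⟨d3, hd3⟩ : ∃ d, d = dirD S e1 b x := ⟨_, rfl⟩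
  obtain ⟨d4, hd4⟩ : ∃ d, d = dirD S e1 c x := ⟨_, rfl⟩
  have a0 : HasDirDeriv S x e0 a d1 := hd1 ▸ hasDirDeriv_dirD haC hx e0
  have a1 : HasDirDeriv S x e1 a d2 := hd2 ▸ hasDirDeriv_dirD haC hx e1
  have b0 : HasDirDeriv S x e0 b d2 := by
    have h := hasDirDeriv_dirD hbC hx e0
    rwa [hb, dirD_comm hS hcl hpC hx, ← hb, ← ha, ← hd2] at h
  have b1 : HasDirDeriv S x e1 b d3 := hd3 ▸ hasDirDeriv_dirD hbC hx e1
  have c0 : HasDirDeriv S x e0 c d3 := by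
    have h := hasDirDeriv_dirD hcC hx e0
    have h2 : dirD S e1 (dirD S e0 q) x = d3 := by
      rw [hd3]
      exact ((hasDirDeriv_dirD hbC hx e1).congr hx hb').dirD_eq hS hx
    rwa [hc, dirD_comm hS hcl hqC hx, ← hc, h2] at h
  have c1 : HasDirDeriv S x e1 c d4 := hd4 ▸ hasDirDeriv_dirD hcC hx e1
  -- the speed and its derivatives
  set u : E → ℝ := fun y => speed (f (s y)) (s y) (p y) (q y) with hu
  set l1 : E → ℝ := fun y => logSpeedD (f (s y)) (f1 (s y)) (s y) (p y) (q y) (p y) (a y) (b y)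
    with hl1
  set l2 : E → ℝ := fun y => logSpeedD (f (s y)) (f1 (s y)) (s y) (p y) (q y) (q y) (b y) (c y)
    with hl2
  have hD0 : ∀ y ∈ S, 0 < gradPoly (f (s y)) (s y) (p y) (q y) := fun y hy =>
    gradPoly_pos (hpos y hy) (hfpos y hy)
  have u0 : ∀ y ∈ S, HasDirDeriv S y e0 u (u y * l1 y) := fun y hy =>
    hasDirDeriv_speed (hf _ (hpos y hy)) (s0 y hy) (p0 y hy) (q0 y hy) (hpos y hy) (hfpos y hy)
  have u1 : ∀ y ∈ S, HasDirDeriv S y e1 u (u y * l2 y) := fun y hy =>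
    hasDirDeriv_speed (hf _ (hpos y hy)) (s1 y hy) (p1 y hy) (q1 y hy) (hpos y hy) (hfpos y hy)
  have hfx := hf _ (hpos x hx)
  have hf1x := hf1 _ (hpos x hx)
  have hx0 := (hpos x hx).ne'
  have hfx0 := (hfpos x hx).ne'
  have hDx := (hD0 x hx).ne'
  obtain ⟨m11, hm11⟩ : ∃ m, m = logSpeedDD (f (s x)) (f1 (s x)) (f2 (s x)) (s x) (p x) (q x) (p x) (a x) (b x)
      (p x) (a x) (b x) (a x) d1 d2 :=
    ⟨_, rfl⟩
  have l11 : HasDirDeriv S x e0 l1 m11 := hm11 ▸ hasDirDeriv_logSpeedD hfx hf1x (s0 x hx) (p0 x hx) (q0 x hx) (p0 x hx) a0 b0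
    hx0 hfx0 hDx
  obtain ⟨m12, hm12⟩ : ∃ m, m = logSpeedDD (f (s x)) (f1 (s x)) (f2 (s x)) (s x) (p x) (q x) (p x) (a x) (b x)
      (q x) (b x) (c x) (b x) d2 d3 :=
    ⟨_, rfl⟩
  have l12 : HasDirDeriv S x e1 l1 m12 := hm12 ▸ hasDirDeriv_logSpeedD hfx hf1x (s1 x hx) (p1 x hx) (q1 x hx) (p1 x hx) a1 b1
    hx0 hfx0 hDx
  obtain ⟨m22, hm22⟩ : ∃ m, m = logSpeedDD (f (s x)) (f1 (s x)) (f2 (s x)) (s x) (p x) (q x) (q x) (b x) (c x)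
      (q x) (b x) (c x) (c x) d3 d4 :=
    ⟨_, rfl⟩
  have l22 : HasDirDeriv S x e1 l2 m22 := hm22 ▸ hasDirDeriv_logSpeedD hfx hf1x (s1 x hx) (p1 x hx) (q1 x hx) (q1 x hx) b1 c1
    hx0 hfx0 hDx
  -- time derivatives of the jets
  have sT : HasDirDeriv S x eT s (u x * 1) := by
    rw [mul_one, show u x = dirD S eT s x from (hT x hx).symm]
    exact hasDirDeriv_dirD hs hx eT
  have hpT : ∀ y ∈ S, dirD S eT p y = u y * l1 y := fun y hy => by
    rw [hp, dirD_comm hS hcl hs hy]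
    exact ((u0 y hy).congr hy hT).dirD_eq hS hy
  have hqT : ∀ y ∈ S, dirD S eT q y = u y * l2 y := fun y hy => by
    rw [hq, dirD_comm hS hcl hs hy]
    exact ((u1 y hy).congr hy hT).dirD_eq hS hy
  have pT : HasDirDeriv S x eT p (u x * l1 x) := hpT x hx ▸ hasDirDeriv_dirD hpC hx eT
  have qT : HasDirDeriv S x eT q (u x * l2 x) := hqT x hx ▸ hasDirDeriv_dirD hqC hx eT
  have aT := hasDirDeriv_dirD haC hx eT
  rw [ha, dirD_comm hS hcl hpC hx, (((u0 x hx).mul l11).congr hx hpT).dirD_eq hS hx, ← ha] at aT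
  have bT := hasDirDeriv_dirD hbC hx eT
  rw [hb, dirD_comm hS hcl hpC hx, (((u1 x hx).mul l12).congr hx hpT).dirD_eq hS hx, ← hb] at bT
  have cT := hasDirDeriv_dirD hcC hx eT
  rw [hc, dirD_comm hS hcl hqC hx, (((u1 x hx).mul l22).congr hx hqT).dirD_eq hS hx, ← hc] at cT
  -- the density and the fluxes
  have JT := hasDirDeriv_curvDensity hfx hf1x sT pT qT
    (aT.congr_deriv (g'' := u x * (m11 + l1 x ^ 2)) (by ring))
    (bT.congr_deriv (g'' := u x * (m12 + l1 x * l2 x)) (by ring))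
    (cT.congr_deriv (g'' := u x * (m22 + l2 x ^ 2)) (by ring)) hx0 hfx0 hDx
  rw [curvDensityD_smul] at JT
  have J0 := hasDirDeriv_curvDensity hfx hf1x (s0 x hx) (p0 x hx) (q0 x hx) a0 b0 c0 hx0 hfx0 hDx
  have J1 := hasDirDeriv_curvDensity hfx hf1x (s1 x hx) (p1 x hx) (q1 x hx) a1 b1 c1 hx0 hfx0 hDx
  have D0 := hasDirDeriv_gradPoly hfx (s0 x hx) (p0 x hx) (q0 x hx)
  have D1 := hasDirDeriv_gradPoly hfx (s1 x hx) (p1 x hx) (q1 x hx)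
  have hL0 : s x ^ 2 * f (s x) + p x ^ 2 ≠ 0 := by
    have := hpos x hx
    have := hfpos x hx
    positivity
  have G0 := hasDirDeriv_gaussFluxX hfx hf1x (s0 x hx) (p0 x hx) (q0 x hx) b0 hx0 hfx0 hL0
  have G1 := hasDirDeriv_gaussFluxY hfx hf1x (s1 x hx) (p1 x hx) (q1 x hx) a1 hx0 hfx0 hL0
  have hux : 0 < u x := speed_pos (hpos x hx) (hfpos x hx)
  have X0 := (J0.mul ((u0 x hx).mul ((((p0 x hx).mul (HasDirDeriv.comp hfx (s0 x hx))).div D0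
    hDx)))).sub ((HasDirDeriv.const 2).mul (G0.div (u0 x hx) hux.ne'))
  have Y1 := (J1.mul ((u1 x hx).mul ((((q1 x hx).mul ((s1 x hx).pow 2)).div D1
    hDx)))).add ((HasDirDeriv.const 2).mul (G1.div (u1 x hx) hux.ne'))
  refine ⟨_, _, X0, Y1, JT.congr_deriv ?_⟩
  have FV := firstVariation_identity (d1 := d1) (d2 := d2) (d3 := d3) (d4 := d4) (f2 := f2 (s x))
    hx0 hfx0 hDx (show l1 x = _ from rfl) (show l2 x = _ from rfl)
  have GB := gaussBonnet_identity (a := a x) (b := b x) (c := c x) (d2 := d2) (f1 := f1 (s x))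
    (f2 := f2 (s x)) hx0 hfx0 hL0 hDx
  rw [show logSpeedD (f (s x)) (f1 (s x)) (s x) (p x) (q x) (p x) (a x) (b x) = l1 x from rfl,
    show logSpeedD (f (s x)) (f1 (s x)) (s x) (p x) (q x) (q x) (b x) (c x) = l2 x from rfl] at GB
  have hu2 : gradPoly (f (s x)) (s x) (p x) (q x) = s x ^ 4 * f (s x) * u x ^ 2 :=
    gradPoly_eq_speed (hpos x hx) (hfpos x hx)
  have hinv : s x ^ 4 * f (s x) / gradPoly (f (s x)) (s x) (p x) (q x) = 1 / u x ^ 2 := by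
    rw [hu2]
    field_simp
  rw [hinv] at GB
  rw [sub_eq_iff_eq_add, ← hm11, ← hm12, ← hm22] at FV
  rw [FV]
  change _ = _ + u x * _
  clear_value u l1 l2
  generalize gradPoly (f (s x)) (s x) (p x) (q x) = D at *
  generalize curvDensity (f (s x)) (f1 (s x)) (s x) (p x) (q x) (a x) (b x) (c x) = J at *
  generalize curvDensityD (f (s x)) (f1 (s x)) (f2 (s x)) (s x) (p x) (q x) (a x) (b x) (c x)
    (p x) (a x) (b x) d1 d2 d3 = Jx at *
  generalize curvDensityD (f (s x)) (f1 (s x)) (f2 (s x)) (s x) (p x) (q x) (a x) (b x) (c x)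
    (q x) (b x) (c x) d2 d3 d4 = Jy at *
  generalize secondFormDet (f (s x)) (f1 (s x)) (s x) (p x) (q x) (a x) (b x) (c x) = K at *
  generalize gradPolyD (f (s x)) (f1 (s x)) (s x) (p x) (q x) (p x) (a x) (b x) = Dx at *
  generalize gradPolyD (f (s x)) (f1 (s x)) (s x) (p x) (q x) (q x) (b x) (c x) = Dy at *
  generalize gaussFluxX (f (s x)) (f1 (s x)) (s x) (p x) (q x) (b x) = A0 at *
  generalize gaussFluxY (f (s x)) (f1 (s x)) (s x) (p x) (q x) (a x) = B0 at *
  generalize gaussFluxXD (f (s x)) (f1 (s x)) (f2 (s x)) (s x) (p x) (q x) (b x) (p x) (a x) (b x)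
    d2 = A1 at *
  generalize gaussFluxYD (f (s x)) (f1 (s x)) (f2 (s x)) (s x) (p x) (q x) (a x) (q x) (b x) (c x)
    d2 = B1 at *
  -- Multiplying the Gauss identity by u moves 1/u inside the divergence: ∂(B/u) = (∂B − l B)/u.
  have hGB : B1 / u x - A1 / u x - B0 * l2 x / u x + A0 * l1 x / u x = u x * (K * s x ^ 4 *
      f (s x) ^ 2 / D ^ 2 - s x * f1 (s x) / 2 + (f1 (s x) / (2 * s x) - f2 (s x) / 2) * p x ^ 2
        * s x ^ 2 * f (s x) / D) := by
    rw [← GB]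
    field_simp
  have e1 : A0 * (u x * l1 x) / u x ^ 2 = A0 * l1 x / u x := by field_simp
  have e2 : B0 * (u x * l2 x) / u x ^ 2 = B0 * l2 x / u x := by field_simp
  rw [e1, e2]
  norm_num
  -- The coefficient 2 is that of H² − |h|² = 2 det h / det g.
  linear_combination (-2) * hGB
end Fields

/-! ### The warping function -/

/-- `Φ(r) = r² F(r)`, the coefficient of `dy²`. -/
def lapse (b r : ℝ) : ℝ := r ^ 2 * warp b r

/-- The derivative of `lapse`. -/
def lapseD (b r : ℝ) : ℝ := 2 * r + 1 / r ^ 2 + 2 * b / r ^ 3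

/-- The second derivative of `lapse`. -/
def lapseDD (b r : ℝ) : ℝ := 2 - 2 / r ^ 3 - 6 * b / r ^ 4

theorem hasDerivAt_warp (b : ℝ) {r : ℝ} (hr : 0 < r) :
    HasDerivAt (warp b) (3 / r ^ 4 + 4 * b / r ^ 5) r := by
  unfold warp
  have h3 := (hasDerivAt_pow 3 r).fun_inv (by positivity)
  have h4 := (hasDerivAt_pow 4 r).fun_inv (by positivity)
  refine ((h3.const_sub 1).sub (h4.const_mul b)).congr_deriv ?_
  norm_num
  field_simp
  ring

theorem hasDerivAt_lapse (b : ℝ) {r : ℝ} (hr : 0 < r) : HasDerivAt (lapse b) (lapseD b r) r := by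
  unfold lapse lapseD
  refine ((hasDerivAt_pow 2 r).mul (hasDerivAt_warp b hr)).congr_deriv ?_
  unfold warp
  norm_num
  field_simp
  ring

theorem hasDerivAt_lapseD (b : ℝ) {r : ℝ} (hr : 0 < r) :
    HasDerivAt (lapseD b) (lapseDD b r) r := by
  unfold lapseD lapseDD
  have h2 := (hasDerivAt_const r (1 : ℝ)).div (hasDerivAt_pow 2 r) (by positivity)
  have h3 := (hasDerivAt_const r (2 * b)).div (hasDerivAt_pow 3 r) (by positivity)
  refine ((((hasDerivAt_id r).const_mul 2).add h2).add h3).congr_deriv ?_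
  norm_num
  field_simp
  ring

theorem warp_strictMonoOn {b : ℝ} (hb : 0 < b) : StrictMonoOn (warp b) (Set.Ioi 0) := by
  refine strictMonoOn_of_deriv_pos (convex_Ioi 0)
    (fun r hr => (hasDerivAt_warp b hr).continuousAt.continuousWithinAt) fun r hr => ?_
  rw [interior_Ioi] at hr
  have hr' : 0 < r := hr
  rw [(hasDerivAt_warp b hr').deriv]
  positivity

theorem warp_pos {b rs r : ℝ} (hb : 0 < b) (hrs : IsCoreRadius b rs) (hr : rs < r) :
    0 < warp b r := by
  rw [← hrs.1.2]
  exact warp_strictMonoOn hb hrs.1.1 (hrs.1.1.trans hr) hr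

theorem periodY_pos {b rs : ℝ} (hb : 0 < b) (hrs : IsCoreRadius b rs) : 0 < periodY b rs := by
  have h0 : 0 < rs := hrs.1.1
  unfold periodY
  rw [(hasDerivAt_warp b h0).deriv]
  have := Real.pi_pos
  positivity

/-! ### The geometry of graphs -/

theorem pd_comp_coord {n : ℕ} (i j : Fin n) {g : ℝ → ℝ} {g' : ℝ} {p : Fin n → ℝ}
    (hg : HasDerivAt g g' (p j)) :
    pd i (fun w => g (w j)) p = if i = j then g' else 0 := by
  unfold pd
  have h := hg.comp_hasFDerivAt p (hasFDerivAt_apply (𝕜 := ℝ) j p)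
  have h2 := congrArg (fun L : (Fin n → ℝ) →L[ℝ] ℝ => L (Pi.single i 1)) h.fderiv
  refine h2.trans ?_
  by_cases hij : i = j
  · subst hij; simp
  · simp [hij, Ne.symm hij]

theorem pd_const {n : ℕ} (i : Fin n) (c : ℝ) (p : Fin n → ℝ) : pd i (fun _ => c) p = 0 := by
  simp [pd]

theorem metric_eq (b : ℝ) (p : Fin 3 → ℝ) :
    metric b p = Matrix.diagonal ![(lapse b (p 0))⁻¹, p 0 ^ 2, lapse b (p 0)] := by
  rw [metric, lapse, mul_inv]

theorem metric_inv {b : ℝ} {p : Fin 3 → ℝ} (hp : 0 < p 0) (hF : 0 < lapse b (p 0)) :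
    (metric b p)⁻¹ = Matrix.diagonal ![lapse b (p 0), (p 0 ^ 2)⁻¹, (lapse b (p 0))⁻¹] := by
  refine Matrix.inv_eq_right_inv ?_
  rw [metric_eq, Matrix.diagonal_mul_diagonal, ← Matrix.diagonal_one]
  congr 1
  ext i
  fin_cases i
  · simp [hF.ne']
  · simp [hp.ne']
  · simp [hF.ne']

theorem pd_metric {b : ℝ} {p : Fin 3 → ℝ} (hp : 0 < p 0) (hF : 0 < lapse b (p 0))
    (a i j : Fin 3) : pd a (fun q => metric b q i j) p =
      if i = j ∧ a = 0 then
        ![-lapseD b (p 0) / lapse b (p 0) ^ 2, 2 * p 0, lapseD b (p 0)] i else 0 := by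
  simp only [metric_eq, Matrix.diagonal_apply]
  by_cases hij : i = j
  · subst hij
    have h0 := hasDerivAt_lapse b hp
    simp only [true_and, if_true]
    fin_cases i
    · exact pd_comp_coord a 0 (h0.fun_inv hF.ne')
    · refine (pd_comp_coord a 0 (hasDerivAt_pow 2 (p 0))).trans ?_
      norm_num
    · exact pd_comp_coord a 0 h0
  · simp [hij, pd_const]

theorem christoffel_metric {b : ℝ} {p : Fin 3 → ℝ} (hp : 0 < p 0) (hF : 0 < lapse b (p 0))
    (c i j : Fin 3) : christoffel (metric b) p c i j = (1 / 2) *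
      (![lapse b (p 0), (p 0 ^ 2)⁻¹, (lapse b (p 0))⁻¹] c *
      (pd i (fun q => metric b q j c) p + pd j (fun q => metric b q i c) p
        - pd c (fun q => metric b q i j) p)) := by
  unfold christoffel
  rw [metric_inv hp hF, Finset.sum_eq_single c]
  · simp
  · intro d _ hd
    simp [Matrix.diagonal_apply_ne _ hd.symm]
  · simp

theorem tangentVec_graphMap (s : (Fin 2 → ℝ) → ℝ) (i : Fin 2) (u : Fin 2 → ℝ) :
    tangentVec (graphMap s) i u = ![pd i s u, if i = 0 then 1 else 0, if i = 1 then 1 else 0] := by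
  ext a
  fin_cases a
  · rfl
  · exact pd_comp_coord i 0 (hasDerivAt_id _)
  · exact pd_comp_coord i 1 (hasDerivAt_id _)

theorem pd_tangentVec_graphMap (s : (Fin 2 → ℝ) → ℝ) (i j : Fin 2) (u : Fin 2 → ℝ) (c : Fin 3) :
    pd i (fun w => tangentVec (graphMap s) j w c) u = ![pd i (pd j s) u, 0, 0] c := by
  simp only [tangentVec_graphMap]
  fin_cases c
  · rfl
  · exact pd_const _ _ _
  · exact pd_const _ _ _

section Graph

variable {b : ℝ} {s : (Fin 2 → ℝ) → ℝ} {u : Fin 2 → ℝ}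

theorem firstForm_graphMap :
    firstForm (metric b) (graphMap s) u =
      !![s u ^ 2 + pd 0 s u ^ 2 / lapse b (s u), pd 0 s u * pd 1 s u / lapse b (s u);
        pd 0 s u * pd 1 s u / lapse b (s u), lapse b (s u) + pd 1 s u ^ 2 / lapse b (s u)] := by
  ext i j
  simp only [firstForm, metricInner, tangentVec_graphMap, metric_eq, graphMap, Fin.sum_univ_three]
  fin_cases i <;> fin_cases j <;> simp <;> ring

/-- The norm of the differential `d(r - s)`. -/
theorem metricInner_conormal (hs : 0 < s u) (hF : 0 < lapse b (s u)) :
    metricInner (metric b (graphMap s u))⁻¹ (conormal s u) (conormal s u)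
      = lapse b (s u) + pd 0 s u ^ 2 / s u ^ 2 + pd 1 s u ^ 2 / lapse b (s u) := by
  rw [metric_inv (by simpa [graphMap] using hs) (by simpa [graphMap] using hF)]
  simp [metricInner, conormal, Fin.sum_univ_three, graphMap, Matrix.diagonal_apply]
  ring

theorem unitNormal_eq (hs : 0 < s u) (hF : 0 < lapse b (s u)) :
    unitNormal b s u = (Real.sqrt (lapse b (s u) + pd 0 s u ^ 2 / s u ^ 2
      + pd 1 s u ^ 2 / lapse b (s u)))⁻¹ •
        ![lapse b (s u), -pd 0 s u / s u ^ 2, -pd 1 s u / lapse b (s u)] := by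
  unfold unitNormal
  rw [metricInner_conormal hs hF,
    metric_inv (by simpa [graphMap] using hs) (by simpa [graphMap] using hF)]
  congr 1
  ext i
  fin_cases i <;> simp [Matrix.mulVec_diagonal, conormal, graphMap] <;> ring

/-- Lowering the index of the normalized gradient returns the conormal over its norm, so only the
Hessian of s and Christoffel terms survive in the second fundamental form. -/
theorem metricInner_unitNormal (hs : 0 < s u) (hF : 0 < lapse b (s u)) (v : Fin 3 → ℝ) :
    metricInner (metric b (graphMap s u)) v (unitNormal b s u)
      = (Real.sqrt (lapse b (s u) + pd 0 s u ^ 2 / s u ^ 2 + pd 1 s u ^ 2 / lapse b (s u)))⁻¹ *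
        (v 0 - pd 0 s u * v 1 - pd 1 s u * v 2) := by
  rw [unitNormal_eq hs hF, metric_eq]
  simp [metricInner, Fin.sum_univ_three, graphMap, Matrix.diagonal_apply]
  field_simp
  ring

theorem secondForm_graphMap (hs : 0 < s u) (hF : 0 < lapse b (s u))
    (hsymm : pd 0 (pd 1 s) u = pd 1 (pd 0 s) u) :
    secondForm (metric b) (graphMap s) (unitNormal b s) u =
      -(Real.sqrt (lapse b (s u) + pd 0 s u ^ 2 / s u ^ 2 + pd 1 s u ^ 2 / lapse b (s u)))⁻¹ •
      !![pd 0 (pd 0 s) u + (-lapseD b (s u) * pd 0 s u ^ 2 / (2 * lapse b (s u))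
            - lapse b (s u) * s u - 2 * pd 0 s u ^ 2 / s u),
          pd 1 (pd 0 s) u - pd 0 s u * pd 1 s u * (lapseD b (s u) / lapse b (s u) + 1 / s u);
        pd 1 (pd 0 s) u - pd 0 s u * pd 1 s u * (lapseD b (s u) / lapse b (s u) + 1 / s u),
          pd 1 (pd 1 s) u + (-3 * lapseD b (s u) * pd 1 s u ^ 2 / (2 * lapse b (s u))
            - lapse b (s u) * lapseD b (s u) / 2)] := by
  have h0 : 0 < graphMap s u 0 := hs
  have hF0 : 0 < lapse b (graphMap s u 0) := hF
  ext i j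
  simp only [secondForm, metricInner_unitNormal hs hF, covTangent, christoffel_metric h0 hF0,
    pd_metric h0 hF0, pd_tangentVec_graphMap, Matrix.of_apply]
  simp only [tangentVec_graphMap, Fin.sum_univ_three]
  rw [show graphMap s u 0 = s u from rfl]
  fin_cases i <;> fin_cases j <;> simp [hsymm] <;> left <;> field_simp <;> ring

/-- With w = |d(r − s)|, the inverse first form contributes 1/(s²w²), the second form 1/w, and the
area density is s w. The odd powers of w cancel, so the density is a rational function of the 2-jet
of s. -/
theorem graphMeanCurvature_density (hs : 0 < s u) (hF : 0 < lapse b (s u))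
    (hsymm : pd 0 (pd 1 s) u = pd 1 (pd 0 s) u) :
    graphMeanCurvature b s u * s u * areaDensity (metric b) (graphMap s) u =
      curvDensity (lapse b (s u)) (lapseD b (s u)) (s u) (pd 0 s u) (pd 1 s u)
        (pd 0 (pd 0 s) u) (pd 1 (pd 0 s) u) (pd 1 (pd 1 s) u) := by
  unfold graphMeanCurvature meanCurvature areaDensity
  rw [firstForm_graphMap, secondForm_graphMap hs hF hsymm]
  have hN : 0 < lapse b (s u) + pd 0 s u ^ 2 / s u ^ 2 + pd 1 s u ^ 2 / lapse b (s u) := by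
    positivity
  have hdet : (!![s u ^ 2 + pd 0 s u ^ 2 / lapse b (s u), pd 0 s u * pd 1 s u / lapse b (s u);
      pd 0 s u * pd 1 s u / lapse b (s u), lapse b (s u) + pd 1 s u ^ 2 / lapse b (s u)]).det
      = s u ^ 2 * (lapse b (s u) + pd 0 s u ^ 2 / s u ^ 2 + pd 1 s u ^ 2 / lapse b (s u)) := by
    rw [Matrix.det_fin_two_of]
    field_simp
    ring
  rw [Matrix.inv_def, hdet, Matrix.adjugate_fin_two_of, Real.sqrt_mul (by positivity),
    Real.sqrt_sq hs.le]
  have hD : gradPoly (lapse b (s u)) (s u) (pd 0 s u) (pd 1 s u) = s u ^ 2 * lapse b (s u) *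
      (lapse b (s u) + pd 0 s u ^ 2 / s u ^ 2 + pd 1 s u ^ 2 / lapse b (s u)) := by
    unfold gradPoly
    field_simp
  have hw := Real.sqrt_pos.2 hN
  unfold curvDensity
  rw [hD]
  simp only [Fin.sum_univ_two, Ring.inverse_eq_inv']
  simp
  unfold curvPoly
  generalize lapse b (s u) + pd 0 s u ^ 2 / s u ^ 2 + pd 1 s u ^ 2 / lapse b (s u) = N at *
  generalize Real.sqrt N = w at *
  field_simp
  ring

/-- The coefficients of dr² and dy² are reciprocal up to r², which leaves √(r²) = r. -/
theorem volumeDensity_metric {p : Fin 3 → ℝ} (hp : 0 < p 0) (hF : 0 < lapse b (p 0)) :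
    volumeDensity (metric b) p = p 0 := by
  unfold volumeDensity
  rw [metric_eq, Matrix.det_diagonal, Fin.prod_univ_three]
  simp only [Matrix.cons_val]
  rw [show (lapse b (p 0))⁻¹ * p 0 ^ 2 * lapse b (p 0) = p 0 ^ 2 by field_simp,
    Real.sqrt_sq hp.le]

end Graph

/-! ### Space-time -/

/-- The domain `[0, T₀) × ℝ²` of a family of height functions. -/
def spaceTime (T₀ : EReal) : Set (ℝ × (Fin 2 → ℝ)) := timeInterval T₀ ×ˢ Set.univ

/-- The time direction. -/
def timeDir : ℝ × (Fin 2 → ℝ) := (1, 0)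

/-- The coordinate directions of the torus. -/
def spaceDir (i : Fin 2) : ℝ × (Fin 2 → ℝ) := (0, Pi.single i 1)

section Domain

variable {T₀ : EReal} {t : ℝ}

theorem mem_spaceTime (ht : t ∈ timeInterval T₀) (p : Fin 2 → ℝ) : (t, p) ∈ spaceTime T₀ :=
  ⟨ht, trivial⟩

theorem convex_timeInterval : Convex ℝ (timeInterval T₀) := by
  refine Set.OrdConnected.convex ⟨fun x hx y hy z hz => ⟨hx.1.trans hz.1, ?_⟩⟩
  exact lt_of_le_of_lt (EReal.coe_le_coe_iff.2 hz.2) hy.2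

theorem interior_timeInterval_nonempty (ht : t ∈ timeInterval T₀) :
    (interior (timeInterval T₀)).Nonempty := by
  obtain ⟨r, h1, h2⟩ := EReal.lt_iff_exists_real_btwn.1 ht.2
  have h3 : t < r := EReal.coe_lt_coe_iff.1 h1
  have hsub : Set.Ioo t r ⊆ timeInterval T₀ := fun x hx =>
    ⟨ht.1.trans hx.1.le, (EReal.coe_lt_coe_iff.2 hx.2).trans h2⟩
  exact (Set.nonempty_Ioo.2 h3).mono (interior_maximal hsub isOpen_Ioo)

theorem convex_spaceTime : Convex ℝ (spaceTime T₀) := convex_timeInterval.prod convex_univ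

theorem interior_spaceTime_nonempty (ht : t ∈ timeInterval T₀) :
    (interior (spaceTime T₀)).Nonempty := by
  rw [spaceTime, interior_prod_eq, interior_univ]
  exact (interior_timeInterval_nonempty ht).prod Set.univ_nonempty

theorem uniqueDiffOn_timeInterval (ht : t ∈ timeInterval T₀) :
    UniqueDiffOn ℝ (timeInterval T₀) :=
  uniqueDiffOn_convex convex_timeInterval (interior_timeInterval_nonempty ht)

theorem uniqueDiffOn_spaceTime (ht : t ∈ timeInterval T₀) : UniqueDiffOn ℝ (spaceTime T₀) :=
  uniqueDiffOn_convex convex_spaceTime (interior_spaceTime_nonempty ht)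

theorem spaceTime_subset_closure (ht : t ∈ timeInterval T₀) :
    spaceTime T₀ ⊆ closure (interior (spaceTime T₀)) := by
  rw [convex_spaceTime.closure_interior_eq_closure_of_nonempty_interior
    (interior_spaceTime_nonempty ht)]
  exact subset_closure

end Domain

/-! ### Restriction to a fixed time or a fixed point of the torus -/

section Slices

variable {T₀ : EReal} {t : ℝ} {h : ℝ × (Fin 2 → ℝ) → ℝ}

theorem hasFDerivAt_slice (hh : ContDiffOn ℝ ∞ h (spaceTime T₀)) (ht : t ∈ timeInterval T₀)
    (p : Fin 2 → ℝ) :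
    HasFDerivAt (fun q => h (t, q))
      ((fderivWithin ℝ h (spaceTime T₀) (t, p)).comp (ContinuousLinearMap.inr ℝ ℝ _)) p := by
  have h1 := ((hh (t, p) (mem_spaceTime ht p)).differentiableWithinAt (by simp)).hasFDerivWithinAt
  have h2 : HasFDerivWithinAt (fun q : Fin 2 → ℝ => (t, q)) (ContinuousLinearMap.inr ℝ ℝ _)
      Set.univ p := (hasFDerivAt_prodMk_right t p).hasFDerivWithinAt
  exact (h1.comp p h2 (fun q _ => mem_spaceTime ht q)).hasFDerivAt Filter.univ_mem

theorem pd_slice (hh : ContDiffOn ℝ ∞ h (spaceTime T₀)) (ht : t ∈ timeInterval T₀) (i : Fin 2)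
    (p : Fin 2 → ℝ) :
    pd i (fun q => h (t, q)) p = dirD (spaceTime T₀) (spaceDir i) h (t, p) := by
  unfold pd
  rw [(hasFDerivAt_slice hh ht p).fderiv]
  rfl

theorem contDiff_slice (hh : ContDiffOn ℝ ∞ h (spaceTime T₀)) (ht : t ∈ timeInterval T₀) :
    ContDiff ℝ ∞ fun q => h (t, q) :=
  contDiffOn_univ.1 (hh.comp (contDiff_prodMk_right t).contDiffOn fun q _ => mem_spaceTime ht q)

theorem hasDerivWithinAt_slice (hh : ContDiffOn ℝ ∞ h (spaceTime T₀)) (ht : t ∈ timeInterval T₀)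
    (p : Fin 2 → ℝ) :
    HasDerivWithinAt (fun τ => h (τ, p)) (dirD (spaceTime T₀) timeDir h (t, p))
      (timeInterval T₀) t := by
  have h1 := ((hh (t, p) (mem_spaceTime ht p)).differentiableWithinAt (by simp)).hasFDerivWithinAt
  have h2 : HasDerivWithinAt (fun τ : ℝ => (τ, p)) ((1 : ℝ), (0 : Fin 2 → ℝ))
      (timeInterval T₀) t :=
    (hasDerivWithinAt_id t _).prodMk (hasDerivWithinAt_const t _ p)
  exact h1.comp_hasDerivWithinAt t h2 (fun τ hτ => mem_spaceTime hτ p)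

end Slices

/-! ### Periodicity -/

theorem periodic_pd {n : ℕ} {g : (Fin n → ℝ) → ℝ} {c : Fin n → ℝ} (hg : Function.Periodic g c)
    (i : Fin n) : Function.Periodic (pd i g) c := by
  intro p
  unfold pd
  rw [← fderiv_comp_add_right, show (fun x => g (x + c)) = g from funext hg]

theorem IsHeightFunction.periodic {rs Px Py : ℝ} {s : (Fin 2 → ℝ) → ℝ}
    (hs : IsHeightFunction rs Px Py s) (m n : ℤ) :
    Function.Periodic s ![m * Px, n * Py] := by
  have h1 : Function.Periodic s ![Px, 0] := hs.periodic_x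
  have h2 : Function.Periodic s ![0, Py] := hs.periodic_y
  have h3 := (h1.zsmul m).add_period (h2.zsmul n)
  rwa [show m • ![Px, 0] + n • ![0, Py] = ![m * Px, n * Py] by
    ext i; fin_cases i <;> simp] at h3

/-! ### The evolution of the height function -/

/-- A particle of the flow stays on the moving graph. Differentiating r = s(t, x, y) along it gives
s_t = (ν^r − s_x ν^x − s_y ν^y)/s, and the bracket is the norm of d(r − s). -/
theorem IsNormalFlow.height_speed {b rs Px Py : ℝ} {T₀ : EReal}
    {φ : ℝ → (Fin 2 → ℝ) → (Fin 3 → ℝ)} {s : ℝ → (Fin 2 → ℝ) → ℝ} (hb : 0 < b)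
    (hrs : IsCoreRadius b rs) (hflow : IsNormalFlow b rs Px Py T₀ φ s) {t : ℝ}
    (ht : t ∈ timeInterval T₀) (p : Fin 2 → ℝ) :
    dirD (spaceTime T₀) timeDir (fun q => s q.1 q.2) (t, p)
      = speed (lapse b (s t p)) (s t p) (pd 0 (s t) p) (pd 1 (s t) p) := by
  have hH := hflow.height t ht
  -- The particle u lies over p at time t only up to a lattice vector (m Px, n Py); this vector is
  -- held fixed along the path.
  obtain ⟨u, m, n, hu⟩ : ∃ u, SpaceEq Px Py (φ t u) (graphMap (s t) p) := by
    have : graphMap (s t) p ∈ {p | ∃ u, SpaceEq Px Py (φ t u) p} := by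
      rw [(hflow.embedded t ht).image_eq]
      exact ⟨p, rfl⟩
    exact this
  have hgraph : ∀ τ ∈ timeInterval T₀, φ τ u 0 = s τ ![φ τ u 1, φ τ u 2] := by
    intro τ hτ
    have : φ τ u ∈ graphSet (s τ) := by
      rw [← (hflow.embedded τ hτ).image_eq]
      exact ⟨u, 0, 0, by ext i; fin_cases i <;> simp⟩
    obtain ⟨p', hp'⟩ := this
    rw [← hp']
    simp only [graphMap, Matrix.cons_val]
    congr 1
    ext i
    fin_cases i <;> rfl
  set p0 : Fin 2 → ℝ := ![φ t u 1, φ t u 2] with hp0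
  have hp : p = p0 + ![m * Px, n * Py] := by
    have h1 := congrFun hu 1
    have h2 := congrFun hu 2
    ext i
    fin_cases i
    · simpa [graphMap, hp0] using h1
    · simpa [graphMap, hp0] using h2
  have hs0 : s t p0 = s t p := by rw [hp, hH.periodic m n p0]
  have hd0 : ∀ i, pd i (s t) p0 = pd i (s t) p := fun i => by
    rw [hp, periodic_pd (hH.periodic m n) i p0]
  have hr : φ t u 0 = s t p := by rw [hgraph t ht, ← hs0]
  have hspos : 0 < s t p := hrs.1.1.trans (hH.gt_core p)
  have hF : 0 < lapse b (s t p) := mul_pos (pow_pos hspos 2) (warp_pos hb hrs (hH.gt_core p))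
  have hν := unitNormal_eq (b := b) (s := s t) (u := p0) (by rwa [hs0]) (by rwa [hs0])
  rw [hs0, hd0, hd0] at hν
  have hfl := hflow.flow t ht u
  rw [← hp0, hν, hr] at hfl
  have hcomp := hasDerivWithinAt_pi.1 hfl
  have hN : 0 < lapse b (s t p) + pd 0 (s t) p ^ 2 / s t p ^ 2
    + pd 1 (s t) p ^ 2 / lapse b (s t p) := by positivity
  set w := Real.sqrt (lapse b (s t p) + pd 0 (s t) p ^ 2 / s t p ^ 2
    + pd 1 (s t) p ^ 2 / lapse b (s t p)) with hw
  have hwpos : 0 < w := Real.sqrt_pos.2 hN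
  have hw2 := Real.sq_sqrt hN.le
  rw [← hw] at hw2
  -- the path of the flow in space-time
  set c1 : ℝ := (s t p)⁻¹ * (w⁻¹ * (-pd 0 (s t) p / s t p ^ 2)) with hc1
  set c2 : ℝ := (s t p)⁻¹ * (w⁻¹ * (-pd 1 (s t) p / lapse b (s t p))) with hc2
  have hpath : HasDerivWithinAt
      (fun τ => ((τ, ![φ τ u 1 + m * Px, φ τ u 2 + n * Py]) : ℝ × (Fin 2 → ℝ)))
      (1, ![c1, c2]) (timeInterval T₀) t := by
    refine (hasDerivWithinAt_id t _).prodMk (hasDerivWithinAt_pi.2 fun i => ?_)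
    fin_cases i
    · simpa using (hcomp 1).add_const (m * Px)
    · simpa using (hcomp 2).add_const (n * Py)
  have hpt : ![φ t u 1 + m * Px, φ t u 2 + n * Py] = p := by
    rw [hp, hp0]
    ext i
    fin_cases i <;> simp
  have hh := hflow.smooth_height
  have hdiff := ((hh (t, p) (mem_spaceTime ht p)).differentiableWithinAt (by simp)).hasFDerivWithinAt
  have hchain : HasDerivWithinAt (fun τ => s τ ![φ τ u 1 + m * Px, φ τ u 2 + n * Py])
      (fderivWithin ℝ (fun q : ℝ × (Fin 2 → ℝ) => s q.1 q.2) (spaceTime T₀) (t, p)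
        (1, ![c1, c2])) (timeInterval T₀) t := by
    refine HasFDerivWithinAt.comp_hasDerivWithinAt
      (l := fun q : ℝ × (Fin 2 → ℝ) => s q.1 q.2) (t := spaceTime T₀) t ?_ hpath
      (fun τ hτ => mem_spaceTime hτ _)
    rw [hpt]
    exact hdiff
  have hheight : ∀ τ ∈ timeInterval T₀,
      s τ ![φ τ u 1 + m * Px, φ τ u 2 + n * Py] = φ τ u 0 := by
    intro τ hτ
    rw [hgraph τ hτ, ← (hflow.height τ hτ).periodic m n ![φ τ u 1, φ τ u 2]]
    simp
  -- The radial coordinate is differentiated in two ways, by the chain rule through s and by the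
  -- flow equation; derivatives within the time interval are unique even at its endpoint.
  have heq := (uniqueDiffOn_timeInterval ht t ht).eq_deriv _ hchain
    ((hcomp 0).congr hheight (hheight t ht))
  have hsplit : ((1, ![c1, c2]) : ℝ × (Fin 2 → ℝ))
      = timeDir + c1 • spaceDir 0 + c2 • spaceDir 1 := by
    refine Prod.ext (by simp [timeDir, spaceDir]) ?_
    ext i
    fin_cases i <;> simp [timeDir, spaceDir]
  rw [hsplit, map_add, map_add, map_smul, map_smul] at heq
  have hd : ∀ i, fderivWithin ℝ (fun q : ℝ × (Fin 2 → ℝ) => s q.1 q.2) (spaceTime T₀) (t, p)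
      (spaceDir i) = pd i (s t) p := fun i => (pd_slice hh ht i p).symm
  rw [hd, hd] at heq
  simp only [Pi.smul_apply, smul_eq_mul, Matrix.cons_val_zero] at heq
  change dirD (spaceTime T₀) timeDir (fun q => s q.1 q.2) (t, p) + _ + _ = _ at heq
  have hgoal : speed (lapse b (s t p)) (s t p) (pd 0 (s t) p) (pd 1 (s t) p)
      = w ^ 2 / (w * s t p) := by
    rw [speed, ← hw]
    field_simp
  rw [hgoal, hw2]
  rw [hc1, hc2] at heq
  rw [add_assoc, ← eq_sub_iff_add_eq] at heq
  rw [heq]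
  field_simp
  ring

open MeasureTheory Filter Topology

/-! ### Integrals over the torus -/

/-- Dominated convergence for difference quotients within I, so the endpoint needs no extension past
it. Convexity of I supplies the mean value inequality behind the dominating constant. -/
theorem hasDerivWithinAt_intervalIntegral {I : Set ℝ} (hI : Convex ℝ I) {t : ℝ} (ht : t ∈ I)
    {K K' : ℝ → ℝ → ℝ} (a c : ℝ)
    (hK' : ContinuousOn (Function.uncurry K') (I ×ˢ Set.univ))
    (hd : ∀ τ ∈ I, ∀ x, HasDerivWithinAt (fun τ => K τ x) (K' τ x) I τ)
    (hK : ∀ τ ∈ I, Continuous (K τ)) :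
    HasDerivWithinAt (fun τ => ∫ x in a..c, K τ x) (∫ x in a..c, K' t x) I t := by
  have hKt : Continuous (K' t) := by
    have : ContinuousOn (fun x => Function.uncurry K' (t, x)) Set.univ :=
      hK'.comp (Continuous.prodMk_right t).continuousOn fun x _ => ⟨ht, trivial⟩
    exact continuousOn_univ.1 this
  obtain ⟨C, hC⟩ := (isCompact_uIcc (a := a) (b := c)).exists_bound_of_continuousOn
    hKt.continuousOn
  -- Compactness of the interval of integration makes the bound on `K'` uniform for τ near t.
  have hev : ∀ᶠ τ in 𝓝 t, ∀ x ∈ Set.uIcc a c, τ ∈ I → ‖K' τ x‖ ≤ C + 1 := by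
    refine (isCompact_uIcc (a := a) (b := c)).eventually_forall_of_forall_eventually
      (P := fun τ x => τ ∈ I → ‖K' τ x‖ ≤ C + 1) fun x hx => ?_
    have hlt : ‖Function.uncurry K' (t, x)‖ < C + 1 := by
      change ‖K' t x‖ < C + 1
      linarith [hC x hx]
    have h1 := (hK' (t, x) ⟨ht, trivial⟩).norm.eventually (gt_mem_nhds hlt)
    filter_upwards [eventually_nhdsWithin_iff.1 h1] with z hz hzI
    exact (hz ⟨hzI, trivial⟩).le
  obtain ⟨δ, hδ, hball⟩ := Metric.eventually_nhds_iff_ball.1 hev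
  rw [hasDerivWithinAt_iff_tendsto_slope]
  have hslope : ∀ᶠ τ in 𝓝[I \ {t}] t, ∫ x in a..c, slope (fun τ => K τ x) t τ
      = slope (fun τ => ∫ x in a..c, K τ x) t τ := by
    filter_upwards [self_mem_nhdsWithin] with τ hτ
    simp only [slope_def_field]
    rw [intervalIntegral.integral_div, intervalIntegral.integral_sub
      ((hK τ hτ.1).intervalIntegrable _ _) ((hK t ht).intervalIntegrable _ _)]
  refine Tendsto.congr' hslope ?_
  refine intervalIntegral.tendsto_integral_filter_of_dominated_convergence (fun _ => C + 1)
    ?_ ?_ (by simp) ?_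
  · filter_upwards [self_mem_nhdsWithin] with τ hτ
    simp only [slope_def_field]
    exact (((hK τ hτ.1).sub (hK t ht)).div_const _).aestronglyMeasurable
  · filter_upwards [self_mem_nhdsWithin, mem_nhdsWithin_of_mem_nhds (Metric.ball_mem_nhds t hδ)]
      with τ hτ hτb
    refine Eventually.of_forall fun x hx => ?_
    have hconv : Convex ℝ (I ∩ Metric.ball t δ) := hI.inter (convex_ball t δ)
    have hle := hconv.norm_image_sub_le_of_norm_hasDerivWithin_le (f := fun τ => K τ x)
      (f' := fun τ => K' τ x) (C := C + 1) (x := t) (y := τ)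
      (fun z hz => (hd z hz.1 x).mono Set.inter_subset_left)
      (fun z hz => hball z hz.2 x (Set.uIoc_subset_uIcc hx) hz.1)
      ⟨ht, Metric.mem_ball_self hδ⟩ ⟨hτ.1, hτb⟩
    have hne : 0 < ‖τ - t‖ := norm_pos_iff.2 (sub_ne_zero.2 hτ.2)
    rw [slope_def_field, norm_div, div_le_iff₀ hne]
    exact hle
  · exact Eventually.of_forall fun x _ => hasDerivWithinAt_iff_tendsto_slope.1 (hd t ht x)

/-- The integral over a fundamental domain of the torus. -/
def torusIntegral (Px Py : ℝ) (g : (Fin 2 → ℝ) → ℝ) : ℝ :=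
  ∫ x in (0 : ℝ)..Px, ∫ y in (0 : ℝ)..Py, g ![x, y]

theorem continuous_vec : Continuous fun z : ℝ × ℝ => ![z.1, z.2] := by
  refine continuous_pi fun i => ?_
  fin_cases i
  · exact continuous_fst
  · exact continuous_snd

theorem continuous_integral_vec {g : (Fin 2 → ℝ) → ℝ} (hg : Continuous g) (Py : ℝ) :
    Continuous fun x => ∫ y in (0 : ℝ)..Py, g ![x, y] :=
  intervalIntegral.continuous_parametric_intervalIntegral_of_continuous'
    (f := fun x y => g ![x, y]) (hg.comp continuous_vec) 0 Py

theorem continuous_slice_vec {g : (Fin 2 → ℝ) → ℝ} (hg : Continuous g) (x : ℝ) :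
    Continuous fun y => g ![x, y] :=
  hg.comp (continuous_vec.comp (Continuous.prodMk_right x))

section Linear

variable {Px Py : ℝ} {g h : (Fin 2 → ℝ) → ℝ}

theorem torusIntegral_add (hg : Continuous g) (hh : Continuous h) :
    torusIntegral Px Py (fun p => g p + h p) = torusIntegral Px Py g + torusIntegral Px Py h := by
  unfold torusIntegral
  rw [← intervalIntegral.integral_add ((continuous_integral_vec hg Py).intervalIntegrable _ _)
    ((continuous_integral_vec hh Py).intervalIntegrable _ _)]
  congr 1
  ext x
  exact intervalIntegral.integral_add ((continuous_slice_vec hg x).intervalIntegrable _ _)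
    ((continuous_slice_vec hh x).intervalIntegrable _ _)

theorem torusIntegral_const_mul (c : ℝ) :
    torusIntegral Px Py (fun p => c * g p) = c * torusIntegral Px Py g := by
  simp [torusIntegral, intervalIntegral.integral_const_mul]

theorem torusIntegral_nonneg (hPx : 0 ≤ Px) (hPy : 0 ≤ Py) (hg : ∀ p, 0 ≤ g p) :
    0 ≤ torusIntegral Px Py g :=
  intervalIntegral.integral_nonneg hPx fun _ _ =>
    intervalIntegral.integral_nonneg hPy fun _ _ => hg _

/-- A point where g is positive can be translated by the lattice into the period rectangle, where
continuity and nonnegativity force a positive integral. -/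
theorem eq_zero_of_torusIntegral_eq_zero (hPx : 0 < Px) (hPy : 0 < Py) (hgc : Continuous g)
    (hg : ∀ p, 0 ≤ g p) (hper : ∀ m n : ℤ, Function.Periodic g ![m * Px, n * Py])
    (h0 : torusIntegral Px Py g = 0) (p : Fin 2 → ℝ) : g p = 0 := by
  by_contra hp
  obtain ⟨m, hm, -⟩ := existsUnique_add_zsmul_mem_Ico hPx (p 0) 0
  obtain ⟨n, hn, -⟩ := existsUnique_add_zsmul_mem_Ico hPy (p 1) 0
  simp only [zero_add, zsmul_eq_mul] at hm hn
  have hgp : 0 < g ![p 0 + m * Px, p 1 + n * Py] := by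
    have h1 := hper m n p
    rw [show p + ![m * Px, n * Py] = ![p 0 + m * Px, p 1 + n * Py] by
      ext i; fin_cases i <;> simp] at h1
    rw [h1]
    exact lt_of_le_of_ne (hg p) (Ne.symm hp)
  have h2 : 0 < torusIntegral Px Py g := by
    refine intervalIntegral.integral_pos hPx (continuous_integral_vec hgc Py).continuousOn
      (fun x _ => intervalIntegral.integral_nonneg hPy.le fun _ _ => hg _)
      ⟨p 0 + m * Px, Set.Ico_subset_Icc_self hm, ?_⟩
    exact intervalIntegral.integral_pos hPy (continuous_slice_vec hgc _).continuousOn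
      (fun _ _ => hg _) ⟨p 1 + n * Py, Set.Ico_subset_Icc_self hn, hgp⟩
  exact h2.ne' h0

theorem hasDerivAt_pd_zero (hg : ContDiff ℝ ∞ g) (x y : ℝ) :
    HasDerivAt (fun x => g ![x, y]) (pd 0 g ![x, y]) x := by
  have h1 : HasDerivAt (fun x : ℝ => ![x, y]) (Pi.single 0 1 : Fin 2 → ℝ) x := by
    refine hasDerivAt_pi.2 fun i => ?_
    fin_cases i
    · exact hasDerivAt_id x
    · exact hasDerivAt_const x y
  exact (hg.differentiable (by simp) _).hasFDerivAt.comp_hasDerivAt x h1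

theorem hasDerivAt_pd_one (hg : ContDiff ℝ ∞ g) (x y : ℝ) :
    HasDerivAt (fun y => g ![x, y]) (pd 1 g ![x, y]) y := by
  have h1 : HasDerivAt (fun y : ℝ => ![x, y]) (Pi.single 1 1 : Fin 2 → ℝ) y := by
    refine hasDerivAt_pi.2 fun i => ?_
    fin_cases i
    · exact hasDerivAt_const y x
    · exact hasDerivAt_id y
  exact (hg.differentiable (by simp) _).hasFDerivAt.comp_hasDerivAt y h1

theorem continuous_pd (hg : ContDiff ℝ ∞ g) (i : Fin 2) : Continuous (pd i g) :=
  (hg.continuous_fderiv (by simp)).clm_apply continuous_const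

theorem torusIntegral_pd_zero (hg : ContDiff ℝ ∞ g) (hper : Function.Periodic g ![Px, 0]) :
    torusIntegral Px Py (pd 0 g) = 0 := by
  unfold torusIntegral
  have hcont := (continuous_pd hg 0).comp continuous_vec
  -- The x-integral must be innermost for the fundamental theorem of calculus; its two endpoint
  -- values agree by periodicity.
  rw [intervalIntegral_intervalIntegral_swap (F := fun x y => pd 0 g ![x, y])]
  · refine intervalIntegral.integral_zero_ae (Eventually.of_forall fun y _ => ?_)
    rw [intervalIntegral.integral_eq_sub_of_hasDerivAt
      (fun x _ => hasDerivAt_pd_zero hg x y)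
      ((hcont.comp (Continuous.prodMk_left y)).intervalIntegrable _ _), sub_eq_zero]
    have := hper ![0, y]
    simpa using this
  · exact (hcont.continuousOn.integrableOn_compact
      (isCompact_uIcc.prod isCompact_uIcc)).mono_set
      (Set.prod_mono Set.uIoc_subset_uIcc Set.uIoc_subset_uIcc)

theorem torusIntegral_pd_one (hg : ContDiff ℝ ∞ g) (hper : Function.Periodic g ![0, Py]) :
    torusIntegral Px Py (pd 1 g) = 0 := by
  unfold torusIntegral
  refine intervalIntegral.integral_zero_ae (Eventually.of_forall fun x _ => ?_)
  rw [intervalIntegral.integral_eq_sub_of_hasDerivAt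
    (fun y _ => hasDerivAt_pd_one hg x y)
    ((continuous_slice_vec (continuous_pd hg 1) x).intervalIntegrable _ _), sub_eq_zero]
  have := hper ![x, 0]
  simpa using this

theorem hasDerivWithinAt_torusIntegral {T₀ : EReal} {t : ℝ} {h : ℝ × (Fin 2 → ℝ) → ℝ}
    (hh : ContDiffOn ℝ ∞ h (spaceTime T₀)) (ht : t ∈ timeInterval T₀) :
    HasDerivWithinAt (fun τ => torusIntegral Px Py fun p => h (τ, p))
      (torusIntegral Px Py fun p => dirD (spaceTime T₀) timeDir h (t, p))
      (timeInterval T₀) t := by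
  have hc := (contDiffOn_dirD (uniqueDiffOn_spaceTime ht) hh timeDir).continuousOn
  -- Differentiation under the integral is applied twice: to the outer x-integral here, and to the
  -- inner y-integral to supply its hypothesis.
  refine hasDerivWithinAt_intervalIntegral convex_timeInterval ht
    (K := fun τ x => ∫ y in (0 : ℝ)..Py, h (τ, ![x, y]))
    (K' := fun τ x => ∫ y in (0 : ℝ)..Py, dirD (spaceTime T₀) timeDir h (τ, ![x, y]))
    0 Px ?_ (fun τ hτ x => ?_) (fun τ hτ => continuous_integral_vec
      (contDiff_slice hh hτ).continuous Py)
  · rw [continuousOn_iff_continuous_domRestrict]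
    refine intervalIntegral.continuous_parametric_intervalIntegral_of_continuous'
      (f := fun (z : ↥(timeInterval T₀ ×ˢ (Set.univ : Set ℝ))) y =>
        dirD (spaceTime T₀) timeDir h (z.1.1, ![z.1.2, y])) ?_ 0 Py
    refine hc.comp_continuous (f := fun w : ↥(timeInterval T₀ ×ˢ (Set.univ : Set ℝ)) × ℝ =>
      (w.1.1.1, ![w.1.1.2, w.2])) ?_ fun w => mem_spaceTime w.1.2.1 _
    exact (continuous_fst.comp (continuous_subtype_val.comp continuous_fst)).prodMk
      (continuous_vec.comp ((continuous_snd.comp (continuous_subtype_val.comp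
        continuous_fst)).prodMk continuous_snd))
  · refine hasDerivWithinAt_intervalIntegral convex_timeInterval hτ
      (K := fun τ y => h (τ, ![x, y]))
      (K' := fun τ y => dirD (spaceTime T₀) timeDir h (τ, ![x, y]))
      0 Py ?_ (fun σ hσ y => hasDerivWithinAt_slice hh hσ _) (fun σ hσ =>
        continuous_slice_vec (contDiff_slice hh hσ).continuous x)
    exact hc.comp ((continuous_fst.prodMk (continuous_vec.comp
      (continuous_const.prodMk continuous_snd))).continuousOn) fun z hz => mem_spaceTime hz.1 _

end Linear

/-! ### The enclosed volume -/

theorem weightedVolume_eq {b rs Px Py : ℝ} {s : (Fin 2 → ℝ) → ℝ} (hb : 0 < b)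
    (hrs : IsCoreRadius b rs) (hs : ∀ p, rs < s p) :
    weightedVolume b rs Px Py s = torusIntegral Px Py fun p => (s p ^ 3 - rs ^ 3) / 3 := by
  unfold weightedVolume torusIntegral
  congr 1
  ext x
  congr 1
  ext y
  have h1 : ∫ r in rs..(s ![x, y]), r * volumeDensity (metric b) ![r, x, y]
      = ∫ r in rs..(s ![x, y]), r ^ 2 := by
    refine intervalIntegral.integral_congr_ae (Eventually.of_forall fun r hr => ?_)
    -- The half-open interval excludes the core radius, where f vanishes and the metric degenerates.
    rw [Set.uIoc_of_le (hs _).le] at hr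
    have hr0 : 0 < r := hrs.1.1.trans hr.1
    have hF : 0 < lapse b r := mul_pos (pow_pos hr0 2) (warp_pos hb hrs hr.1)
    rw [volumeDensity_metric (by simpa using hr0) (by simpa using hF)]
    simp
    ring
  rw [h1, integral_pow]
  norm_num

/-! ### Smoothness of the jet functions -/

section Smooth

variable {E : Type*} [NormedAddCommGroup E] [NormedSpace ℝ E] {S : Set E} {f f1 s p q a b c : E → ℝ}

theorem contDiffOn_lapse {β : ℝ} (hs : ContDiffOn ℝ ∞ s S) (h0 : ∀ y ∈ S, s y ≠ 0) :
    ContDiffOn ℝ ∞ (fun y => lapse β (s y)) S := by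
  unfold lapse warp
  exact (hs.pow 2).mul ((contDiffOn_const.sub
    ((hs.pow 3).inv fun y hy => pow_ne_zero 3 (h0 y hy))).sub
    (contDiffOn_const.mul ((hs.pow 4).inv fun y hy => pow_ne_zero 4 (h0 y hy))))

theorem contDiffOn_lapseD {β : ℝ} (hs : ContDiffOn ℝ ∞ s S) (h0 : ∀ y ∈ S, s y ≠ 0) :
    ContDiffOn ℝ ∞ (fun y => lapseD β (s y)) S := by
  unfold lapseD
  exact ((contDiffOn_const.mul hs).add (contDiffOn_const.div (hs.pow 2)
    fun y hy => pow_ne_zero 2 (h0 y hy))).add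
    (contDiffOn_const.div (hs.pow 3) fun y hy => pow_ne_zero 3 (h0 y hy))

theorem contDiffOn_gradPoly (hf : ContDiffOn ℝ ∞ f S) (hs : ContDiffOn ℝ ∞ s S)
    (hp : ContDiffOn ℝ ∞ p S) (hq : ContDiffOn ℝ ∞ q S) :
    ContDiffOn ℝ ∞ (fun y => gradPoly (f y) (s y) (p y) (q y)) S := by
  unfold gradPoly
  fun_prop

theorem contDiffOn_curvDensity (hf : ContDiffOn ℝ ∞ f S) (hf1 : ContDiffOn ℝ ∞ f1 S)
    (hs : ContDiffOn ℝ ∞ s S) (hp : ContDiffOn ℝ ∞ p S) (hq : ContDiffOn ℝ ∞ q S)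
    (ha : ContDiffOn ℝ ∞ a S) (hb : ContDiffOn ℝ ∞ b S) (hc : ContDiffOn ℝ ∞ c S)
    (h0 : ∀ y ∈ S, 0 < s y) (hf0 : ∀ y ∈ S, 0 < f y) : ContDiffOn ℝ ∞
      (fun y => curvDensity (f y) (f1 y) (s y) (p y) (q y) (a y) (b y) (c y)) S := by
  unfold curvDensity
  refine ContDiffOn.div ?_ ((contDiffOn_const.mul hf).mul (contDiffOn_gradPoly hf hs hp hq))
    fun y hy => ?_
  · unfold curvPoly
    fun_prop
  · have := hf0 y hy
    have := gradPoly_pos (p := p y) (q := q y) (h0 y hy) (hf0 y hy)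
    positivity

theorem contDiffOn_speed (hf : ContDiffOn ℝ ∞ f S)
    (hs : ContDiffOn ℝ ∞ s S) (hp : ContDiffOn ℝ ∞ p S) (hq : ContDiffOn ℝ ∞ q S)
    (h0 : ∀ y ∈ S, 0 < s y) (hf0 : ∀ y ∈ S, 0 < f y) :
    ContDiffOn ℝ ∞ (fun y => speed (f y) (s y) (p y) (q y)) S := by
  unfold speed
  refine (((hf.add ((hp.pow 2).div (hs.pow 2) fun y hy => pow_ne_zero 2 (h0 y hy).ne')).add
    ((hq.pow 2).div hf fun y hy => (hf0 y hy).ne')).sqrt fun y hy => ?_).div hs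
    fun y hy => (h0 y hy).ne'
  have := hf0 y hy
  have := h0 y hy
  have hN : 0 < f y + p y ^ 2 / s y ^ 2 + q y ^ 2 / f y := by positivity
  exact hN.ne'

theorem contDiffOn_gaussFluxY (hf : ContDiffOn ℝ ∞ f S) (hf1 : ContDiffOn ℝ ∞ f1 S)
    (hs : ContDiffOn ℝ ∞ s S) (hp : ContDiffOn ℝ ∞ p S) (hq : ContDiffOn ℝ ∞ q S)
    (ha : ContDiffOn ℝ ∞ a S) (h0 : ∀ y ∈ S, 0 < s y) (hf0 : ∀ y ∈ S, 0 < f y) :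
    ContDiffOn ℝ ∞ (fun y => gaussFluxY (f y) (f1 y) (s y) (p y) (q y) (a y)) S := by
  unfold gaussFluxY
  refine (hq.mul (ha.add ((((hf1.neg.mul (hp.pow 2)).div (contDiffOn_const.mul hf)
    fun y hy => ?_).sub (hf.mul hs)).sub ((contDiffOn_const.mul (hp.pow 2)).div hs
    fun y hy => (h0 y hy).ne')))).div (((hs.pow 2).mul hf).add (hp.pow 2)) fun y hy => ?_
  all_goals
    have := hf0 y hy
    have := h0 y hy
    positivity

theorem contDiffOn_gaussFluxX (hf : ContDiffOn ℝ ∞ f S) (hf1 : ContDiffOn ℝ ∞ f1 S)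
    (hs : ContDiffOn ℝ ∞ s S) (hp : ContDiffOn ℝ ∞ p S) (hq : ContDiffOn ℝ ∞ q S)
    (hb : ContDiffOn ℝ ∞ b S) (h0 : ∀ y ∈ S, 0 < s y) (hf0 : ∀ y ∈ S, 0 < f y) :
    ContDiffOn ℝ ∞ (fun y => gaussFluxX (f y) (f1 y) (s y) (p y) (q y) (b y)) S := by
  unfold gaussFluxX
  refine ((hq.mul (hb.sub ((hp.mul hq).mul ((hf1.div (contDiffOn_const.mul hf)
    fun y hy => ?_).add (contDiffOn_const.div hs fun y hy => (h0 y hy).ne'))))).div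
    (((hs.pow 2).mul hf).add (hp.pow 2)) fun y hy => ?_).add
    ((hp.mul hf1).div (contDiffOn_const.mul (hs.pow 2)) fun y hy => ?_)
  all_goals
    have := hf0 y hy
    have := h0 y hy
    positivity

theorem contDiffOn_fluxX {f f1 : ℝ → ℝ} (hf : ContDiffOn ℝ ∞ (fun y => f (s y)) S)
    (hf1 : ContDiffOn ℝ ∞ (fun y => f1 (s y)) S)
    (hs : ContDiffOn ℝ ∞ s S) (hp : ContDiffOn ℝ ∞ p S) (hq : ContDiffOn ℝ ∞ q S)
    (ha : ContDiffOn ℝ ∞ a S) (hb : ContDiffOn ℝ ∞ b S) (hc : ContDiffOn ℝ ∞ c S)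
    (h0 : ∀ y ∈ S, 0 < s y) (hf0 : ∀ y ∈ S, 0 < f (s y)) :
    ContDiffOn ℝ ∞ (fluxX f f1 s p q a b c) S := by
  unfold fluxX
  have hu := contDiffOn_speed hf hs hp hq h0 hf0
  exact ((contDiffOn_curvDensity hf hf1 hs hp hq ha hb hc h0 hf0).mul
    (hu.mul ((hp.mul hf).div (contDiffOn_gradPoly hf hs hp hq)
      fun y hy => (gradPoly_pos (h0 y hy) (hf0 y hy)).ne'))).sub
    (contDiffOn_const.mul ((contDiffOn_gaussFluxX hf hf1 hs hp hq hb h0 hf0).div hu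
      fun y hy => (speed_pos (h0 y hy) (hf0 y hy)).ne'))

theorem contDiffOn_fluxY {f f1 : ℝ → ℝ} (hf : ContDiffOn ℝ ∞ (fun y => f (s y)) S)
    (hf1 : ContDiffOn ℝ ∞ (fun y => f1 (s y)) S)
    (hs : ContDiffOn ℝ ∞ s S) (hp : ContDiffOn ℝ ∞ p S) (hq : ContDiffOn ℝ ∞ q S)
    (ha : ContDiffOn ℝ ∞ a S) (hb : ContDiffOn ℝ ∞ b S) (hc : ContDiffOn ℝ ∞ c S)
    (h0 : ∀ y ∈ S, 0 < s y) (hf0 : ∀ y ∈ S, 0 < f (s y)) :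
    ContDiffOn ℝ ∞ (fluxY f f1 s p q a b c) S := by
  unfold fluxY
  have hu := contDiffOn_speed hf hs hp hq h0 hf0
  exact ((contDiffOn_curvDensity hf hf1 hs hp hq ha hb hc h0 hf0).mul
    (hu.mul ((hq.mul (hs.pow 2)).div (contDiffOn_gradPoly hf hs hp hq)
      fun y hy => (gradPoly_pos (h0 y hy) (hf0 y hy)).ne'))).add
    (contDiffOn_const.mul ((contDiffOn_gaussFluxY hf hf1 hs hp hq ha h0 hf0).div hu
      fun y hy => (speed_pos (h0 y hy) (hf0 y hy)).ne'))

end Smooth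

/-! ### The monotonicity formula -/

/-- The integrand of `-dQ/dt`. -/
def defect (b s p q : ℝ) : ℝ :=
  speed (lapse b s) s p q * ((2 * (warp b s + b / s ^ 4) * p ^ 2 * s ^ 2 * lapse b s
    + 2 * lapse b s * s ^ 2 * q ^ 2) / gradPoly (lapse b s) s p q)

section Defect

variable {b s p q : ℝ}

theorem defect_nonneg (hb : 0 < b) (hs : 0 < s) (hF : 0 < warp b s) : 0 ≤ defect b s p q := by
  have hf : 0 < lapse b s := mul_pos (pow_pos hs 2) hF
  have := speed_pos (p := p) (q := q) hs hf
  have := gradPoly_pos (p := p) (q := q) hs hf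
  unfold defect
  positivity

theorem defect_eq_zero_iff (hb : 0 < b) (hs : 0 < s) (hF : 0 < warp b s) :
    defect b s p q = 0 ↔ p = 0 ∧ q = 0 := by
  have hf : 0 < lapse b s := mul_pos (pow_pos hs 2) hF
  have hu := speed_pos (p := p) (q := q) hs hf
  have hD := gradPoly_pos (p := p) (q := q) hs hf
  unfold defect
  rw [mul_eq_zero, or_iff_right hu.ne', div_eq_zero_iff, or_iff_left hD.ne',
    add_eq_zero_iff_of_nonneg (by positivity) (by positivity)]
  have h4 : warp b s + b / s ^ 4 ≠ 0 := by positivity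
  simp [h4, hs.ne', hf.ne']

/-- For f = r² − r⁻¹ − b r⁻² one has 2 r f' + r² f''/2 + f = 6 r², which explains the constant 6 in
Q, and f''/2 − 3f/r² = −2(F + b/r⁴), which fixes the sign of the gradient term. -/
theorem reaction_eq_sub_defect (hs : 0 < s) :
    speed (lapse b s) s p q * (2 * s * lapseD b s + s ^ 2 * lapseDD b s / 2 + lapse b s
      + ((lapseDD b s / 2 - 3 * lapse b s / s ^ 2) * p ^ 2 * s ^ 2 * lapse b s
        - 2 * lapse b s * s ^ 2 * q ^ 2) / gradPoly (lapse b s) s p q)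
      = 6 * (s ^ 2 * speed (lapse b s) s p q) - defect b s p q := by
  have h1 : 2 * s * lapseD b s + s ^ 2 * lapseDD b s / 2 + lapse b s = 6 * s ^ 2 := by
    unfold lapseD lapseDD lapse warp
    field_simp
    ring
  have h2 : lapseDD b s / 2 - 3 * lapse b s / s ^ 2 = -(2 * (warp b s + b / s ^ 4)) := by
    unfold lapseDD lapse warp
    field_simp
    ring
  rw [h1, h2]
  unfold defect
  ring

end Defect

/-! ### The derivative of Q and the equality case -/

theorem isCoordinateTorus_iff {s : (Fin 2 → ℝ) → ℝ} (hs : ContDiff ℝ ∞ s) :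
    IsCoordinateTorus s ↔ ∀ p, pd 0 s p = 0 ∧ pd 1 s p = 0 := by
  constructor
  · rintro ⟨c, hc⟩ p
    rw [show s = fun _ => c from funext hc]
    exact ⟨pd_const _ _ _, pd_const _ _ _⟩
  · intro h
    refine ⟨s 0, fun p => is_const_of_fderiv_eq_zero (𝕜 := ℝ) (hs.differentiable (by simp))
      (fun x => ?_) p 0⟩
    ext v
    have hv : v = v 0 • Pi.single 0 1 + v 1 • Pi.single 1 1 := by
      ext i
      fin_cases i <;> simp
    have h0 : fderiv ℝ s x (Pi.single 0 1) = 0 := (h x).1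
    have h1 : fderiv ℝ s x (Pi.single 1 1) = 0 := (h x).2
    rw [hv, map_add, map_smul, map_smul, h0, h1]
    simp

theorem continuous_defect {b rs Px Py : ℝ} {s : (Fin 2 → ℝ) → ℝ} (hb : 0 < b)
    (hrs : IsCoreRadius b rs) (hs : IsHeightFunction rs Px Py s) :
    Continuous fun x => defect b (s x) (pd 0 s x) (pd 1 s x) := by
  have h0 : ∀ x, 0 < s x := fun x => hrs.1.1.trans (hs.gt_core x)
  have hF : ∀ x, 0 < lapse b (s x) := fun x =>
    mul_pos (pow_pos (h0 x) 2) (warp_pos hb hrs (hs.gt_core x))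
  have hc := hs.smooth.continuous
  have hp := continuous_pd hs.smooth 0
  have hq := continuous_pd hs.smooth 1
  have hw : Continuous fun x => warp b (s x) := by
    unfold warp
    exact (continuous_const.sub ((hc.pow 3).inv₀ fun x => pow_ne_zero 3 (h0 x).ne')).sub
      (continuous_const.mul ((hc.pow 4).inv₀ fun x => pow_ne_zero 4 (h0 x).ne'))
  have hl : Continuous fun x => lapse b (s x) := (hc.pow 2).mul hw
  have hu : Continuous fun x => speed (lapse b (s x)) (s x) (pd 0 s x) (pd 1 s x) := by
    unfold speed
    exact ((hl.add ((hp.pow 2).div (hc.pow 2) fun x => pow_ne_zero 2 (h0 x).ne')).add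
      ((hq.pow 2).div hl fun x => (hF x).ne')).sqrt.div hc fun x => (h0 x).ne'
  have hb4 : Continuous fun x => b / s x ^ 4 :=
    continuous_const.div (hc.pow 4) fun x => pow_ne_zero 4 (h0 x).ne'
  unfold defect
  refine hu.mul (Continuous.div (by fun_prop) ?_ fun x => (gradPoly_pos (h0 x) (hF x)).ne')
  unfold gradPoly
  fun_prop

theorem hasDerivWithinAt_Q {b rs Px : ℝ} {T₀ : EReal} {φ : ℝ → (Fin 2 → ℝ) → (Fin 3 → ℝ)}
    {s : ℝ → (Fin 2 → ℝ) → ℝ} {Py : ℝ} (hb : 0 < b) (hrs : IsCoreRadius b rs)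
    (hflow : IsNormalFlow b rs Px Py T₀ φ s) {t : ℝ} (ht : t ∈ timeInterval T₀) :
    HasDerivWithinAt (fun τ => Q b rs Px Py (s τ))
      (-torusIntegral Px Py fun p => defect b (s t p) (pd 0 (s t) p) (pd 1 (s t) p))
      (timeInterval T₀) t := by
  set S := spaceTime T₀ with hSdef
  have hS : UniqueDiffOn ℝ S := uniqueDiffOn_spaceTime ht
  have hcl : S ⊆ closure (interior S) := spaceTime_subset_closure ht
  obtain ⟨h, hh⟩ : ∃ h : ℝ × (Fin 2 → ℝ) → ℝ, h = fun x => s x.1 x.2 := ⟨_, rfl⟩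
  have hC : ContDiffOn ℝ ∞ h S := hh ▸ hflow.smooth_height
  obtain ⟨p, hp⟩ : ∃ p, p = dirD S (spaceDir 0) h := ⟨_, rfl⟩
  obtain ⟨q, hq⟩ : ∃ q, q = dirD S (spaceDir 1) h := ⟨_, rfl⟩
  obtain ⟨a, ha⟩ : ∃ a, a = dirD S (spaceDir 0) p := ⟨_, rfl⟩
  obtain ⟨m, hm⟩ : ∃ m, m = dirD S (spaceDir 1) p := ⟨_, rfl⟩
  obtain ⟨c, hc⟩ : ∃ c, c = dirD S (spaceDir 1) q := ⟨_, rfl⟩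
  have hpC : ContDiffOn ℝ ∞ p S := hp ▸ contDiffOn_dirD hS hC _
  have hqC : ContDiffOn ℝ ∞ q S := hq ▸ contDiffOn_dirD hS hC _
  have haC : ContDiffOn ℝ ∞ a S := ha ▸ contDiffOn_dirD hS hpC _
  have hmC : ContDiffOn ℝ ∞ m S := hm ▸ contDiffOn_dirD hS hpC _
  have hcC : ContDiffOn ℝ ∞ c S := hc ▸ contDiffOn_dirD hS hqC _
  have hcore : ∀ y ∈ S, rs < h y := fun y hy => by
    rw [hh]
    exact (hflow.height y.1 hy.1).gt_core y.2
  have hpos : ∀ y ∈ S, 0 < h y := fun y hy => hrs.1.1.trans (hcore y hy)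
  have hfpos : ∀ y ∈ S, 0 < lapse b (h y) := fun y hy =>
    mul_pos (pow_pos (hpos y hy) 2) (warp_pos hb hrs (hcore y hy))
  have hfC : ContDiffOn ℝ ∞ (fun y => lapse b (h y)) S :=
    contDiffOn_lapse hC fun y hy => (hpos y hy).ne'
  have hf1C : ContDiffOn ℝ ∞ (fun y => lapseD b (h y)) S :=
    contDiffOn_lapseD hC fun y hy => (hpos y hy).ne'
  -- the jets at a fixed time
  have hhτ : ∀ τ x, h (τ, x) = s τ x := fun τ x => by rw [hh]
  have hslice : ∀ τ, (fun x => h (τ, x)) = s τ := fun τ => funext (hhτ τ)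
  have hpτ : ∀ τ ∈ timeInterval T₀, (fun x => p (τ, x)) = pd 0 (s τ) := fun τ hτ => by
    ext x
    rw [hp, ← pd_slice hC hτ 0 x, hslice]
  have hqτ : ∀ τ ∈ timeInterval T₀, (fun x => q (τ, x)) = pd 1 (s τ) := fun τ hτ => by
    ext x
    rw [hq, ← pd_slice hC hτ 1 x, hslice]
  have haτ : ∀ τ ∈ timeInterval T₀, (fun x => a (τ, x)) = pd 0 (pd 0 (s τ)) := fun τ hτ => by
    ext x
    rw [ha, ← pd_slice hpC hτ 0 x, hpτ τ hτ]
  have hmτ : ∀ τ ∈ timeInterval T₀, (fun x => m (τ, x)) = pd 1 (pd 0 (s τ)) := fun τ hτ => by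
    ext x
    rw [hm, ← pd_slice hpC hτ 1 x, hpτ τ hτ]
  have hcτ : ∀ τ ∈ timeInterval T₀, (fun x => c (τ, x)) = pd 1 (pd 1 (s τ)) := fun τ hτ => by
    ext x
    rw [hc, ← pd_slice hqC hτ 1 x, hqτ τ hτ]
  have hsymm : ∀ τ ∈ timeInterval T₀, ∀ x, pd 0 (pd 1 (s τ)) x = pd 1 (pd 0 (s τ)) x := by
    intro τ hτ x
    rw [← hqτ τ hτ, ← hpτ τ hτ, pd_slice hqC hτ 0 x, pd_slice hpC hτ 1 x, hp, hq]
    exact dirD_comm hS hcl hC (mem_spaceTime hτ x)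
  have hT : ∀ y ∈ S, dirD S timeDir h y = speed (lapse b (h y)) (h y) (p y) (q y) := by
    rintro ⟨τ, x⟩ hy
    have h1 := congrFun (hpτ τ hy.1) x
    have h2 := congrFun (hqτ τ hy.1) x
    rw [h1, h2, hh]
    exact hflow.height_speed hb hrs hy.1 x
  -- the integrand of the curvature term
  obtain ⟨J, hJ⟩ : ∃ J : ℝ × (Fin 2 → ℝ) → ℝ, J = fun y =>
    curvDensity (lapse b (h y)) (lapseD b (h y)) (h y) (p y) (q y) (a y) (m y) (c y) := ⟨_, rfl⟩
  have hJC : ContDiffOn ℝ ∞ J S :=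
    hJ ▸ contDiffOn_curvDensity hfC hf1C hC hpC hqC haC hmC hcC hpos hfpos
  obtain ⟨X, hX⟩ : ∃ X, X = fluxX (lapse b) (lapseD b) h p q a m c := ⟨_, rfl⟩
  obtain ⟨Y, hY⟩ : ∃ Y, Y = fluxY (lapse b) (lapseD b) h p q a m c := ⟨_, rfl⟩
  have hXC : ContDiffOn ℝ ∞ X S :=
    hX ▸ contDiffOn_fluxX hfC hf1C hC hpC hqC haC hmC hcC hpos hfpos
  have hYC : ContDiffOn ℝ ∞ Y S :=
    hY ▸ contDiffOn_fluxY hfC hf1C hC hpC hqC haC hmC hcC hpos hfpos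
  -- The curvature density changes by a divergence, plus six times the rate of the volume density,
  -- minus the defect.
  have hJT : ∀ x, dirD S timeDir J (t, x) = (pd 0 (fun x => X (t, x)) x
      + pd 1 (fun x => Y (t, x)) x) + (6 * (s t x ^ 2 * dirD S timeDir h (t, x))
        + (-1) * defect b (s t x) (pd 0 (s t) x) (pd 1 (s t) x)) := by
    intro x
    have hy := mem_spaceTime ht x
    obtain ⟨X', Y', hX', hY', hJ'⟩ := hasDirDeriv_curvDensity_of_flow hS hcl hC hpos hfpos
      (fun r hr => hasDerivAt_lapse b hr) (fun r hr => hasDerivAt_lapseD b hr) hp hq ha hm hc hT hy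
    rw [← hX] at hX'
    rw [← hY] at hY'
    rw [← hJ] at hJ'
    rw [hJ'.dirD_eq hS hy, pd_slice hXC ht, pd_slice hYC ht, hX'.dirD_eq hS hy,
      hY'.dirD_eq hS hy, reaction_eq_sub_defect (hpos _ hy), hT _ hy, ← hpτ t ht, ← hqτ t ht, hhτ]
    ring
  -- the integrand of the volume term
  have hVC : ContDiffOn ℝ ∞ (fun y => (h y ^ 3 - rs ^ 3) / 3) S :=
    ((hC.pow 3).sub contDiffOn_const).div_const 3
  have hVT : ∀ x, dirD S timeDir (fun y => (h y ^ 3 - rs ^ 3) / 3) (t, x)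
      = s t x ^ 2 * dirD S timeDir h (t, x) := by
    intro x
    have hy := mem_spaceTime ht x
    have h1 := ((((hasDirDeriv_dirD hC hy timeDir).pow 3).sub
      (HasDirDeriv.const (rs ^ 3))).div (HasDirDeriv.const 3) (by norm_num)).dirD_eq hS hy
    rw [h1, hhτ]
    norm_num
    ring
  have hmain := (hasDerivWithinAt_torusIntegral (Px := Px) (Py := Py) hJC ht).sub
    ((hasDerivWithinAt_torusIntegral (Px := Px) (Py := Py) hVC ht).const_mul 6)
  have hQ : ∀ τ ∈ timeInterval T₀, Q b rs Px Py (s τ) = torusIntegral Px Py (fun x => J (τ, x))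
      - 6 * torusIntegral Px Py (fun x => (h (τ, x) ^ 3 - rs ^ 3) / 3) := by
    intro τ hτ
    unfold Q
    rw [weightedVolume_eq hb hrs (hflow.height τ hτ).gt_core]
    simp only [hhτ]
    congr 1
    unfold weightedMeanCurvatureIntegral torusIntegral
    congr 1
    ext x
    congr 1
    ext y
    have hy := mem_spaceTime hτ ![x, y]
    have h1 := hpos _ hy
    have h2 := hfpos _ hy
    rw [hhτ] at h1 h2
    rw [graphMeanCurvature_density h1 h2 (hsymm τ hτ _), hJ, ← hcτ τ hτ, ← hmτ τ hτ, ← haτ τ hτ,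
      ← hpτ τ hτ, ← hqτ τ hτ]
    simp only [hhτ]
  refine (hmain.congr hQ (hQ t ht)).congr_deriv ?_
  -- the divergence terms integrate to zero
  have hXt := contDiff_slice hXC ht
  have hYt := contDiff_slice hYC ht
  have hH := hflow.height t ht
  -- Both fluxes are functions of the 2-jet of the height function, so they inherit its periods.
  have hper : ∀ {v}, Function.Periodic (s t) v → ∀ x, h (t, x + v) = h (t, x) ∧
      p (t, x + v) = p (t, x) ∧ q (t, x + v) = q (t, x) ∧ a (t, x + v) = a (t, x) ∧
      m (t, x + v) = m (t, x) ∧ c (t, x + v) = c (t, x) := by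
    intro v hv x
    have key : ∀ {g : ℝ × (Fin 2 → ℝ) → ℝ} {g' : (Fin 2 → ℝ) → ℝ}, (fun x => g (t, x)) = g' →
        Function.Periodic g' v → g (t, x + v) = g (t, x) := fun e hg => by
      have := hg x
      rwa [← e] at this
    exact ⟨key (hslice t) hv, key (hpτ t ht) (periodic_pd hv 0), key (hqτ t ht) (periodic_pd hv 1),
      key (haτ t ht) (periodic_pd (periodic_pd hv 0) 0),
      key (hmτ t ht) (periodic_pd (periodic_pd hv 0) 1),
      key (hcτ t ht) (periodic_pd (periodic_pd hv 1) 1)⟩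
  have hXper : Function.Periodic (fun x => X (t, x)) ![Px, 0] := fun x => by
    obtain ⟨e1, e2, e3, e4, e5, e6⟩ := hper hH.periodic_x x
    simp only [hX, fluxX, e1, e2, e3, e4, e5, e6]
  have hYper : Function.Periodic (fun x => Y (t, x)) ![0, Py] := fun x => by
    obtain ⟨e1, e2, e3, e4, e5, e6⟩ := hper hH.periodic_y x
    simp only [hY, fluxY, e1, e2, e3, e4, e5, e6]
  have hVcont : Continuous fun x => s t x ^ 2 * dirD S timeDir h (t, x) :=
    (hH.smooth.continuous.pow 2).mul
      (contDiff_slice (contDiffOn_dirD hS hC timeDir) ht).continuous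
  have hdcont := continuous_defect hb hrs hH
  rw [← hSdef]
  simp only [hJT, hVT]
  have hdiv : Continuous fun x => pd 0 (fun x => X (t, x)) x + pd 1 (fun x => Y (t, x)) x :=
    (continuous_pd hXt 0).add (continuous_pd hYt 1)
  have hrest : Continuous fun x => 6 * (s t x ^ 2 * dirD S timeDir h (t, x))
      + (-1) * defect b (s t x) (pd 0 (s t) x) (pd 1 (s t) x) :=
    (hVcont.const_mul 6).add (hdcont.const_mul (-1))
  rw [torusIntegral_add hdiv hrest,
    torusIntegral_add (continuous_pd hXt 0) (continuous_pd hYt 1),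
    torusIntegral_add (hVcont.const_mul 6) (hdcont.const_mul (-1)),
    torusIntegral_const_mul, torusIntegral_const_mul,
    torusIntegral_pd_zero hXt hXper, torusIntegral_pd_one hYt hYper]
  ring

/-- The defect is continuous, periodic and nonnegative, so a vanishing integral forces it to vanish
everywhere. This is equivalent to ds = 0, hence to constancy of s. -/
theorem torusIntegral_defect {b rs Px Py : ℝ} {s : (Fin 2 → ℝ) → ℝ} (hb : 0 < b)
    (hrs : IsCoreRadius b rs) (hPx : 0 < Px) (hPy : 0 < Py) (hs : IsHeightFunction rs Px Py s) :
    0 ≤ torusIntegral Px Py (fun x => defect b (s x) (pd 0 s x) (pd 1 s x)) ∧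
      (torusIntegral Px Py (fun x => defect b (s x) (pd 0 s x) (pd 1 s x)) = 0 ↔
        IsCoordinateTorus s) := by
  have h0 : ∀ x, 0 < s x := fun x => hrs.1.1.trans (hs.gt_core x)
  have hF : ∀ x, 0 < warp b (s x) := fun x => warp_pos hb hrs (hs.gt_core x)
  have hnonneg : ∀ x, 0 ≤ defect b (s x) (pd 0 s x) (pd 1 s x) := fun x =>
    defect_nonneg hb (h0 x) (hF x)
  refine ⟨torusIntegral_nonneg hPx.le hPy.le hnonneg, ?_⟩
  rw [isCoordinateTorus_iff hs.smooth]
  constructor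
  · intro h x
    refine (defect_eq_zero_iff hb (h0 x) (hF x)).1 (eq_zero_of_torusIntegral_eq_zero hPx hPy
      (continuous_defect hb hrs hs) hnonneg (fun m n y => ?_) h x)
    have hper := hs.periodic m n
    simp only [hper y, periodic_pd hper 0 y, periodic_pd hper 1 y]
  · intro h
    have : ∀ x, defect b (s x) (pd 0 s x) (pd 1 s x) = 0 := fun x =>
      (defect_eq_zero_iff hb (h0 x) (hF x)).2 (h x)
    simp [torusIntegral, this]

end AdSMelvin
end

theorem proposition4p1 (b rs Px : ℝ) (hb : 0 < b) (hrs : AdSMelvin.IsCoreRadius b rs)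
    (hPx : 0 < Px) (T₀ : EReal) (φ : ℝ → (Fin 2 → ℝ) → (Fin 3 → ℝ))
    (s : ℝ → (Fin 2 → ℝ) → ℝ)
    (hflow : AdSMelvin.IsNormalFlow b rs Px (AdSMelvin.periodY b rs) T₀ φ s)
    (t : ℝ) (ht : t ∈ AdSMelvin.timeInterval T₀) :
    ∃ Q' : ℝ,
      HasDerivWithinAt (fun τ => AdSMelvin.Q b rs Px (AdSMelvin.periodY b rs) (s τ)) Q'
        (AdSMelvin.timeInterval T₀) t ∧
      Q' ≤ 0 ∧ (Q' = 0 ↔ AdSMelvin.IsCoordinateTorus (s t)) := by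
  obtain ⟨h1, h2⟩ := AdSMelvin.torusIntegral_defect hb hrs hPx (AdSMelvin.periodY_pos hb hrs)
    (hflow.height t ht)
  exact ⟨_, AdSMelvin.hasDerivWithinAt_Q hb hrs hflow ht, neg_nonpos.2 h1, neg_eq_zero.trans h2⟩
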